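/- Let $n\ge 2$; write points of $\mathbb{C}^n$ as $z=(z',z_n)\in\mathbb{C}^{n-1}\times\mathbb{C}$, with Euclidean norms. Let $A=\{\frac1k:k=1,2,\dots\}$. (1) There is a sequence $(x_k)\subset(0,1)\setminus A$ whose set of limit points is exactly $\bar A=A\cup\{0\}$. (2) For every such $(x_k)$ there is a sequence $c_k>0$ decreasing to $0$ such that $$\lambda(z)=\sum_{k}c_k\log|z-x_k|,\qquad z\in\mathbb{C}\quad(\log 0=-\infty),$$ is subharmonic on $\mathbb{C}$ and $\lambda\ge-\frac12$ on $A$. (3) For all such $(x_k),(c_k)$ there are open discs $D_k\subset\mathbb{C}$ of positive radius, centred at $x_k$, with $\lambda<-1$ on $D_k$ for every $k$. (4) For every choice of such $(x_k)$, $(c_k)$, $(D_k)$, put $$K=\Big\{z\in\mathbb{C}^n:|z'|=|z_n|,\ z_n\notin\bigcup_kD_k\Big\},\qquad \Omega=\{z\in\mathbb{C}^n:|z'|^2+|z_n-1|^2<1\}\setminus K,$$ $$u(z)=\begin{cases}-1&\text{if }z\in\Omega,\ |z'|<|z_n|,\\ \max\{\lambda(z_n),-1\}&\text{if }z\in\Omega,\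 |z'|\ge|z_n|.\end{cases}$$ Then $\Omega$ is a domain (open and connected), $0\in\partial\Omega$, $u$ is plurisubharmonic on $\Omega$, and for no open neighbourhood $U$ of $0$ is $u|_{U\cap\Omega}$ the pointwise limit of a decreasing sequence of $C^\infty$ plurisubharmonic functions on $U\cap\Omega$. The same holds for the function obtained from $u$ by exchanging the two pieces, i.e. $\max\{\lambda(z_n),-1\}$ where $|z'|<|z_n|$ and $-1$ where $|z'|\ge|z_n|$. Consequently, for no open neighbourhood $U$ of the boundary point $0$ is $U\cap\Omega$ an $\mathcal S$-domain, that is, a domain on which every plurisubharmonic function is the limit of a decreasing sequence of $C^\infty$ plurisubharmonic functions. Thus the conclusion that every boundary point of a domain $D$ has a neighbourhood $U$ with $D\cap U$ an $\mathcal S$-domain, which holds when $D$ has Lipschitz boundary, fails for $\Omega$ at $0$. -/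

import Mathlib

open Set Filter Topology MeasureTheory

noncomputable section

namespace PSHExample

/-- The space `ℂ^N` with its Euclidean norm. -/
abbrev Cn (N : ℕ) : Type := EuclideanSpace ℂ (Fin N)

/-- The mean `(1 / 2π) ∫₀^{2π} f(θ) dθ` of an extended-real function, as the integral of the
positive part minus the integral of the negative part. -/
def circleMean (f : ℝ → EReal) : EReal :=
  (((∫⁻ θ in Ioc 0 (2 * Real.pi), (f θ).toENNReal) / ENNReal.ofReal (2 * Real.pi) : ENNReal)
      : EReal)
    - (((∫⁻ θ in Ioc 0 (2 * Real.pi), (-f θ).toENNReal) / ENNReal.ofReal (2 * Real.pi) : ENNReal)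
      : EReal)

/-- Plurisubharmonic functions with values in `[-∞, ∞)` on an open set `D`: upper semicontinuous
functions satisfying the local sub-mean value inequality on every complex line.
For `E = ℂ` these are the subharmonic functions on `D`. -/
structure IsPSHOn {E : Type*} [NormedAddCommGroup E] [NormedSpace ℂ E]
    (u : E → EReal) (D : Set E) : Prop where
  usc : UpperSemicontinuousOn u D
  lt_top : ∀ a ∈ D, u a < ⊤
  submean : ∀ a ∈ D, ∀ b : E, ∃ ρ : ℝ, 0 < ρ ∧ ∀ t : ℝ, 0 < t → t < ρ →
    u a ≤ circleMean (fun θ => u (a + ((t : ℂ) * Complex.exp (θ * Complex.I)) • b))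

/-- On `D`, the function `u` is the pointwise limit of a decreasing sequence of (real-valued)
`C^∞` plurisubharmonic functions on `D`. -/
def IsDecreasingSmoothLimitOn {N : ℕ} (u : Cn N → EReal) (D : Set (Cn N)) : Prop :=
  ∃ v : ℕ → Cn N → ℝ,
    (∀ q, ContDiffOn ℝ ((⊤ : ℕ∞) : WithTop ℕ∞) (v q) D ∧
      IsPSHOn (fun z => (v q z : EReal)) D) ∧
    (∀ q, ∀ z ∈ D, v (q + 1) z ≤ v q z) ∧
    ∀ z ∈ D, Tendsto (fun q => (v q z : EReal)) atTop (𝓝 (u z))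

/-- `𝒮`-domains: domains on which every plurisubharmonic function is the limit of a decreasing
sequence of smooth plurisubharmonic functions. -/
def IsSDomain {N : ℕ} (D : Set (Cn N)) : Prop :=
  IsOpen D ∧ IsConnected D ∧
    ∀ u : Cn N → EReal, IsPSHOn u D → IsDecreasingSmoothLimitOn u D

/-- The set `A = {1/k : k = 1, 2, …}`. -/
def setA : Set ℝ := {a | ∃ k : ℕ, 1 ≤ k ∧ a = 1 / (k : ℝ)}

/-- A sequence in `(0,1) ∖ A` whose set of limit points is the closure of `A`. -/
structure IsPoints (x : ℕ → ℝ) : Prop where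
  mem : ∀ k, x k ∈ Ioo (0 : ℝ) 1 \ setA
  limits : {a : ℝ | MapClusterPt a atTop x} = closure setA

/-- `λ(z) = ∑ c_k log |z - x_k|`, with `log 0 = -∞` and the sum taken in `[-∞, ∞]`. -/
def lam (x c : ℕ → ℝ) (z : ℂ) : EReal :=
  ∑' k, (c k : EReal) * ENNReal.log ‖z - (x k : ℂ)‖ₑ

/-- Positive coefficients decreasing to `0` such that `λ` is subharmonic on `ℂ` and
`λ ≥ -1/2` on `A`. -/
structure IsCoeffs (x c : ℕ → ℝ) : Prop where
  pos : ∀ k, 0 < c k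
  anti : Antitone c
  tendsto_zero : Tendsto c atTop (𝓝 0)
  subharmonic : IsPSHOn (lam x c) (univ : Set ℂ)
  ge_on_A : ∀ a ∈ setA, ((-1 / 2 : ℝ) : EReal) ≤ lam x c (a : ℂ)

/-- Radii of discs `D_k` centred at `x_k` with `λ < -1` on `D_k`. -/
structure IsRadii (x c r : ℕ → ℝ) : Prop where
  pos : ∀ k, 0 < r k
  lt_on_disc : ∀ k, ∀ z ∈ Metric.ball (x k : ℂ) (r k), lam x c z < -1

/-- The first `m` coordinates `z'` of `z = (z', z_n) ∈ ℂ^m × ℂ`, where `n = m + 1`. -/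
def fstPart {m : ℕ} (z : Cn (m + 1)) : Cn m := WithLp.toLp 2 (fun i => z i.castSucc)

/-- The last coordinate `z_n` of `z = (z', z_n) ∈ ℂ^m × ℂ`, where `n = m + 1`. -/
def lastPart {m : ℕ} (z : Cn (m + 1)) : ℂ := z (Fin.last m)

/-- `K = {|z'| = |z_n|, z_n ∉ ⋃ D_k}`. -/
def setK (m : ℕ) (x r : ℕ → ℝ) : Set (Cn (m + 1)) :=
  {z | ‖fstPart z‖ = ‖lastPart z‖ ∧ lastPart z ∉ ⋃ k, Metric.ball (x k : ℂ) (r k)}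

/-- `Ω = {|z'|² + |z_n - 1|² < 1} ∖ K`. -/
def Omega (m : ℕ) (x r : ℕ → ℝ) : Set (Cn (m + 1)) :=
  {z | ‖fstPart z‖ ^ 2 + ‖lastPart z - 1‖ ^ 2 < 1} \ setK m x r

open Classical in
/-- The function equal to `-1` where `|z'| < |z_n|` and to `max {λ(z_n), -1}` elsewhere. -/
def exampleFun (m : ℕ) (x c : ℕ → ℝ) (z : Cn (m + 1)) : EReal :=
  if ‖fstPart z‖ < ‖lastPart z‖ then -1 else max (lam x c (lastPart z)) (-1)

open Classical in
/-- The function with the two pieces exchanged: `max {λ(z_n), -1}` where `|z'| < |z_n|` and `-1`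
elsewhere. -/
def exampleFunSwap (m : ℕ) (x c : ℕ → ℝ) (z : Cn (m + 1)) : EReal :=
  if ‖fstPart z‖ < ‖lastPart z‖ then max (lam x c (lastPart z)) (-1) else -1

end PSHExample

end

noncomputable section

namespace PSHExample

/-! Over a disc `D_k` one has `max {λ, -1} = -1`, so the two pieces of `u` agree there. Deleting `K`
removes every other point of the cone `|z'| = |z_n|` from the ball. Hence near each point of `Ω` the
function `u` coincides with `-1` or with `max {λ(z_n), -1}`, and plurisubharmonicity, being local,
follows from subharmonicity of `λ`.

Approximation fails because of the slices over `A`. Fix `a ∈ A` near `0`. In the slice `z_n = a` the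
function jumps across the circle `|ζ| = a`, where `z' = ζe` with `e` a unit vector: it is `-1` on
one side and at least `-1/2` on the other. The slices `z_n = x_j`, with `x_j` arbitrarily close to
`a`, meet `Ω` in a full disc `|ζ| ≤ 2a`, since the cone is not deleted over the centre of `D_j`. A
continuous approximant carries its values off the critical circle from the slice over `a` to a
nearby slice over some `x_j`, and there it is subharmonic in `ζ` on the whole disc. If the outside
is the high side, the three circles inequality (`le_add_log_of_submeanAt`) forbids a fixed increase
between the radii `a e^{-η}` and `a e^η` as `η → 0`, the bound on `|ζ| = 2a` being uniform because
the sequence decreases. If the inside is the high side, the maximum principle (`le_of_submeanAt`) is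
violated. `exists_forall_lt_of_antitone` and `eventually_forall_slice_lt` supply the compactness.

The analysis of `λ` rests on `lam_eq`: on a bounded set `λ` is a finite constant minus a series with
terms in `[0, ∞]`, to which Tonelli and lower semicontinuity apply without integrability conditions.
-/

/-! ### The potential as a constant minus a series in `[0, ∞]` -/

/-- The non-negative function `L - log |w|` on the disc `|w| ≤ exp L`, with values in `[0, ∞]`. -/
def logGap (L : ℝ) (w : ℂ) : ENNReal := ((L : EReal) - ENNReal.log ‖w‖ₑ).toENNReal

lemma logGap_zero (L : ℝ) : logGap L 0 = ⊤ := by simp [logGap]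

lemma log_enorm {w : ℂ} (hw : w ≠ 0) : ENNReal.log ‖w‖ₑ = (Real.log ‖w‖ : ℝ) := by
  rw [← ofReal_norm, ENNReal.log_ofReal_of_pos (norm_pos_iff.2 hw)]

lemma logGap_of_ne_zero (L : ℝ) {w : ℂ} (hw : w ≠ 0) :
    logGap L w = ENNReal.ofReal (L - Real.log ‖w‖) := by
  rw [logGap, log_enorm hw, ← EReal.coe_sub, EReal.real_coe_toENNReal]

lemma log_norm_le {L : ℝ} {w : ℂ} (hw : w ≠ 0) (h : ‖w‖ ≤ Real.exp L) : Real.log ‖w‖ ≤ L :=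
  (Real.log_le_iff_le_exp (norm_pos_iff.2 hw)).2 h

lemma continuous_logGap (L : ℝ) : Continuous (logGap L) := by
  refine EReal.continuous_toENNReal.comp ?_
  have h : Continuous fun y : EReal => (L : EReal) - y := by
    simp_rw [sub_eq_add_neg]
    refine continuous_iff_continuousAt.2 fun y => ?_
    exact ContinuousAt.comp (f := fun y : EReal => ((L : EReal), -y))
      (g := fun p : EReal × EReal => p.1 + p.2) (EReal.continuousAt_add (by simp) (by simp))
      (by fun_prop)
  exact h.comp (ENNReal.continuous_log.comp continuous_enorm)

lemma coe_mul_log_enorm {c L : ℝ} (hc : 0 < c) {w : ℂ} (h : ‖w‖ ≤ Real.exp L) :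
    (c : EReal) * ENNReal.log ‖w‖ₑ
      = ((c * L : ℝ) : EReal) - ((ENNReal.ofReal c * logGap L w : ENNReal) : EReal) := by
  rcases eq_or_ne w 0 with rfl | hw
  · rw [logGap_zero, ENNReal.mul_top (by simpa using hc)]
    simp [EReal.coe_mul_bot_of_pos hc]
  · have h1 := log_norm_le hw h
    rw [logGap_of_ne_zero L hw, log_enorm hw, ← ENNReal.ofReal_mul hc.le,
      EReal.coe_ennreal_ofReal, max_eq_left (by nlinarith), ← EReal.coe_mul, ← EReal.coe_sub]
    congr 1
    ring

lemma sum_coe_sub_coe (s : Finset ℕ) (r : ℕ → ℝ) (p : ℕ → ENNReal) :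
    ∑ k ∈ s, ((r k : EReal) - (p k : EReal))
      = ((∑ k ∈ s, r k : ℝ) : EReal) - ((∑ k ∈ s, p k : ENNReal) : EReal) := by
  induction s using Finset.cons_induction with
  | empty => simp
  | cons a s ha ih =>
    rw [Finset.sum_cons, Finset.sum_cons, Finset.sum_cons, ih, EReal.coe_add, EReal.coe_ennreal_add,
      sub_eq_add_neg, sub_eq_add_neg, sub_eq_add_neg,
      EReal.neg_add (Or.inl (EReal.coe_ennreal_ne_bot _)) (Or.inr (EReal.coe_ennreal_ne_bot _)),
      sub_eq_add_neg, add_add_add_comm]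

lemma continuous_coe_sub_coe (r : ℝ) :
    Continuous fun p : ENNReal => (r : EReal) - (p : EReal) := by
  simp_rw [sub_eq_add_neg]
  refine continuous_iff_continuousAt.2 fun y => ?_
  exact ContinuousAt.comp (f := fun y : ENNReal => ((r : EReal), -(y : EReal)))
    (g := fun p : EReal × EReal => p.1 + p.2) (EReal.continuousAt_add (by simp) (by simp))
    (by have := continuous_coe_ennreal_ereal; fun_prop)

lemma antitone_coe_sub_coe (r : ℝ) :
    Antitone fun p : ENNReal => (r : EReal) - (p : EReal) := fun _ _ h =>
  EReal.sub_le_sub le_rfl (EReal.coe_ennreal_le_coe_ennreal_iff.2 h)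

/-- Addition on `EReal` is continuous at the limit pair because its first entry is finite; the
second series may diverge to `∞`. -/
lemma hasSum_coe_sub_coe {r : ℕ → ℝ} (hr : Summable r) (p : ℕ → ENNReal) :
    HasSum (fun k => (r k : EReal) - (p k : EReal))
      (((∑' k, r k : ℝ) : EReal) - ((∑' k, p k : ENNReal) : EReal)) := by
  simp only [HasSum, SummationFilter.unconditional_filter, sum_coe_sub_coe]
  have h1 : Tendsto (fun s : Finset ℕ => ((∑ k ∈ s, r k : ℝ) : EReal)) atTop
      (𝓝 ((∑' k, r k : ℝ) : EReal)) :=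
    (continuous_coe_real_ereal.tendsto _).comp hr.hasSum
  have h2 : Tendsto (fun s : Finset ℕ => -((∑ k ∈ s, p k : ENNReal) : EReal)) atTop
      (𝓝 (-((∑' k, p k : ENNReal) : EReal))) :=
    (continuous_neg.tendsto _).comp
      ((continuous_coe_ennreal_ereal.tendsto _).comp (ENNReal.summable (f := p)).hasSum)
  simp_rw [sub_eq_add_neg]
  exact (EReal.continuousAt_add (p := (((∑' k, r k : ℝ) : EReal), -((∑' k, p k : ENNReal) : EReal)))
    (by simp) (by simp)).tendsto.comp (h1.prodMk_nhds h2)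

/-- The sum of the gaps `c_k (L - log |z - x_k|)`. -/
def potGap (x c : ℕ → ℝ) (L : ℝ) (z : ℂ) : ENNReal :=
  ∑' k, ENNReal.ofReal (c k) * logGap L (z - (x k : ℂ))

lemma lam_eq {x c : ℕ → ℝ} (hc : ∀ k, 0 < c k) (hs : Summable c) {L : ℝ} {z : ℂ}
    (h : ∀ k, ‖z - (x k : ℂ)‖ ≤ Real.exp L) :
    lam x c z = ((∑' k, c k * L : ℝ) : EReal) - (potGap x c L z : EReal) := by
  simp_rw [lam, coe_mul_log_enorm (hc _) (h _)]
  exact (hasSum_coe_sub_coe (hs.mul_right L) _).tsum_eq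

lemma lowerSemicontinuous_potGap (x c : ℕ → ℝ) (L : ℝ) : LowerSemicontinuous (potGap x c L) :=
  lowerSemicontinuous_tsum fun _ => ((ENNReal.continuous_const_mul ENNReal.ofReal_ne_top).comp
    ((continuous_logGap L).comp (continuous_id.sub continuous_const))).lowerSemicontinuous

/-! ### Circle means and subharmonicity of the potential -/

lemma circleMean_mono {f g : ℝ → EReal} (h : ∀ θ, f θ ≤ g θ) : circleMean f ≤ circleMean g := by
  refine EReal.sub_le_sub ?_ ?_ <;> refine EReal.coe_ennreal_le_coe_ennreal_iff.2 ?_ <;>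
    gcongr with θ
  · exact EReal.toENNReal_le_toENNReal (h θ)
  · exact EReal.toENNReal_le_toENNReal (EReal.neg_le_neg_iff.2 (h θ))

lemma volume_Ioc_two_pi : volume (Ioc 0 (2 * Real.pi)) = ENNReal.ofReal (2 * Real.pi) := by
  rw [Real.volume_Ioc, sub_zero]

lemma ofReal_two_pi_ne_zero : ENNReal.ofReal (2 * Real.pi) ≠ 0 := by
  simpa using Real.pi_pos

lemma setLIntegral_const_div (a : ENNReal) :
    (∫⁻ _ in Ioc 0 (2 * Real.pi), a) / ENNReal.ofReal (2 * Real.pi) = a := by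
  rw [setLIntegral_const, volume_Ioc_two_pi,
    ENNReal.mul_div_cancel_right ofReal_two_pi_ne_zero ENNReal.ofReal_ne_top]

/-- For `r ≥ 0` the positive and negative parts of `r - P` are the truncated differences `r - P` and
`P - r` in `[0, ∞]`. Integrating `r + (P - r) = max r P = (r - P) + P` links the circle mean to the
mean of `P` without subtracting infinities. -/
lemma le_circleMean_coe_sub_coe {r : ℝ} (hr : 0 ≤ r) {P : ℝ → ENNReal} (hP : Measurable P)
    {A : ENNReal}
    (h : (∫⁻ θ in Ioc 0 (2 * Real.pi), P θ) / ENNReal.ofReal (2 * Real.pi) ≤ A) :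
    (r : EReal) - (A : EReal) ≤ circleMean (fun θ => (r : EReal) - (P θ : EReal)) := by
  rcases eq_or_ne A ⊤ with rfl | hA
  · simp
  have e1 : ∀ θ, ((r : EReal) - (P θ : EReal)).toENNReal = ENNReal.ofReal r - P θ := fun θ => by
    rw [EReal.toENNReal_sub (EReal.coe_ennreal_nonneg _), EReal.real_coe_toENNReal,
      EReal.toENNReal_coe]
  have e2 : ∀ θ, (-((r : EReal) - (P θ : EReal))).toENNReal = P θ - ENNReal.ofReal r := fun θ => by
    rw [EReal.neg_sub (Or.inl (EReal.coe_ne_bot _)) (Or.inl (EReal.coe_ne_top _)), add_comm,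
      ← sub_eq_add_neg, EReal.toENNReal_sub (EReal.coe_nonneg.2 hr), EReal.real_coe_toENNReal,
      EReal.toENNReal_coe]
  simp_rw [circleMean, e1, e2]
  set T := ENNReal.ofReal (2 * Real.pi)
  set μ := volume.restrict (Ioc 0 (2 * Real.pi))
  have key : ENNReal.ofReal r + (∫⁻ θ, (P θ - ENNReal.ofReal r) ∂μ) / T
      = (∫⁻ θ, (ENNReal.ofReal r - P θ) ∂μ) / T + (∫⁻ θ, P θ ∂μ) / T := by
    rw [← setLIntegral_const_div (ENNReal.ofReal r), ← ENNReal.add_div, ← ENNReal.add_div,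
      setLIntegral_const_div, ← lintegral_add_left measurable_const, ← lintegral_add_right _ hP]
    congr 2 with θ
    rw [add_tsub_eq_max, tsub_add_eq_max]
  have f1 : (∫⁻ θ, (P θ - ENNReal.ofReal r) ∂μ) / T ≤ A := by
    refine le_trans ?_ h
    gcongr
    exact tsub_le_self
  have f2 : (∫⁻ θ, (ENNReal.ofReal r - P θ) ∂μ) / T ≤ ENNReal.ofReal r := by
    refine le_trans ?_ (setLIntegral_const_div _).le
    gcongr
    exact tsub_le_self
  generalize (∫⁻ θ, (P θ - ENNReal.ofReal r) ∂μ) / T = m at *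
  generalize (∫⁻ θ, (ENNReal.ofReal r - P θ) ∂μ) / T = p at *
  generalize (∫⁻ θ, P θ ∂μ) / T = q at *
  have hm := ne_top_of_le_ne_top hA f1
  have hp := ne_top_of_le_ne_top ENNReal.ofReal_ne_top f2
  have hq := ne_top_of_le_ne_top hA h
  lift r to NNReal using hr
  rw [ENNReal.ofReal_coe_nnreal] at key
  lift A to NNReal using hA
  lift m to NNReal using hm
  lift p to NNReal using hp
  lift q to NNReal using hq
  have key' : (r : ℝ) + m = p + q := by exact_mod_cast key
  have h' : (q : ℝ) ≤ A := by exact_mod_cast h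
  have : (r : ℝ) - A ≤ p - m := by linarith
  simp only [EReal.coe_nnreal_eq_coe_real, ← EReal.coe_sub]
  exact EReal.coe_le_coe_iff.2 this

lemma add_smul_exp_eq {w b : ℂ} (hb : b ≠ 0) (t θ : ℝ) :
    w + ((t : ℂ) * Complex.exp (θ * Complex.I)) • b = b * (circleMap 0 t θ - -w / b) := by
  rw [circleMap_zero, smul_eq_mul]
  field_simp
  ring

lemma ae_add_smul_exp_ne_zero {w b : ℂ} (hb : b ≠ 0) {t : ℝ} (ht : t ≠ 0) :
    ∀ᵐ θ : ℝ ∂volume.restrict (Ioc 0 (2 * Real.pi)),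
      w + ((t : ℂ) * Complex.exp (θ * Complex.I)) • b ≠ 0 := by
  rw [ae_restrict_iff' measurableSet_Ioc, ae_iff]
  refine Set.Subsingleton.measure_zero (fun θ₁ h₁ θ₂ h₂ => ?_) _
  simp only [mem_ofPred_eq, Classical.not_imp, not_not, add_smul_exp_eq hb, mul_eq_zero, hb,
    false_or, sub_eq_zero] at h₁ h₂
  exact injOn_circleMap_of_abs_sub_le ht (a := 0) (b := 2 * Real.pi) (c := 0)
    (by rw [zero_sub, abs_neg, abs_of_pos Real.two_pi_pos])
    (by rw [uIoc_of_le Real.two_pi_pos.le]; exact h₁.1)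
    (by rw [uIoc_of_le Real.two_pi_pos.le]; exact h₂.1) (h₁.2.trans h₂.2.symm)

/-- Jensen's formula: the mean of `log |z - u|` over `|z| = t` is `log t + log⁺ (|u| / t)`, which is
at least `log |u|`. The affine circle is reduced to this one by factoring out `b`, with `u = -w /
b`. -/
lemma mean_logGap_le {L t : ℝ} (ht : 0 < t) (w b : ℂ)
    (h : ∀ θ : ℝ, ‖w + ((t : ℂ) * Complex.exp (θ * Complex.I)) • b‖ ≤ Real.exp L) :
    (∫⁻ θ : ℝ in Ioc 0 (2 * Real.pi),
      logGap L (w + ((t : ℂ) * Complex.exp (θ * Complex.I)) • b)) / ENNReal.ofReal (2 * Real.pi)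
      ≤ logGap L w := by
  rcases eq_or_ne b 0 with rfl | hb
  · simp only [smul_zero, add_zero]
    exact (setLIntegral_const_div _).le
  rcases eq_or_ne w 0 with rfl | hw
  · simp [logGap_zero]
  set u : ℂ := -w / b
  have hu : u ≠ 0 := by simp [u, hw, hb]
  have hae := ae_add_smul_exp_ne_zero (w := w) hb ht.ne'
  have hlog : ∀ θ : ℝ, w + ((t : ℂ) * Complex.exp (θ * Complex.I)) • b ≠ 0 →
      Real.log ‖w + ((t : ℂ) * Complex.exp (θ * Complex.I)) • b‖
        = Real.log ‖b‖ + Real.log ‖circleMap 0 t θ - u‖ := fun θ hθ => by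
    rw [add_smul_exp_eq hb] at hθ ⊢
    rw [norm_mul, Real.log_mul (norm_ne_zero_iff.2 hb)
      (norm_ne_zero_iff.2 (right_ne_zero_of_mul hθ))]
  have e1 : ∫⁻ θ : ℝ in Ioc 0 (2 * Real.pi),
      logGap L (w + ((t : ℂ) * Complex.exp (θ * Complex.I)) • b)
      = ∫⁻ θ : ℝ in Ioc 0 (2 * Real.pi),
        ENNReal.ofReal (L - Real.log ‖b‖ - Real.log ‖circleMap 0 t θ - u‖) := by
    refine lintegral_congr_ae (hae.mono fun θ hθ => ?_)
    dsimp only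
    rw [logGap_of_ne_zero L hθ, hlog θ hθ, sub_add_eq_sub_sub]
  have hint : CircleIntegrable (fun z => Real.log ‖z - u‖) 0 t :=
    circleIntegrable_log_norm_sub_const t
  have hint' : Integrable (fun θ => Real.log ‖circleMap 0 t θ - u‖)
      (volume.restrict (Ioc 0 (2 * Real.pi))) :=
    (intervalIntegrable_iff_integrableOn_Ioc_of_le Real.two_pi_pos.le).1 hint
  have havg := circleAverage_log_norm_sub_const_eq_log_radius_add_posLog (a := u) (c := 0) ht.ne'
  rw [Real.circleAverage, intervalIntegral.integral_of_le Real.two_pi_pos.le, smul_eq_mul] at havg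
  have hge : Real.log ‖u‖ ≤ Real.log t + Real.posLog (t⁻¹ * ‖0 - u‖) := by
    rw [zero_sub, norm_neg]
    have : Real.log (t⁻¹ * ‖u‖) ≤ Real.posLog (t⁻¹ * ‖u‖) := le_max_right _ _
    rw [Real.log_mul (inv_ne_zero ht.ne') (norm_ne_zero_iff.2 hu), Real.log_inv] at this
    linarith
  rw [e1, ← ofReal_integral_eq_lintegral_ofReal
      (f := fun θ => L - Real.log ‖b‖ - Real.log ‖circleMap 0 t θ - u‖)
      ((integrable_const _).sub hint')
    (hae.mono fun θ hθ => by
      have := log_norm_le hθ (h θ)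
      rw [hlog θ hθ] at this
      simp only [Pi.zero_apply]
      linarith),
    ← ENNReal.ofReal_div_of_pos Real.two_pi_pos, logGap_of_ne_zero L hw]
  refine ENNReal.ofReal_le_ofReal ?_
  rw [integral_sub (integrable_const _) hint', setIntegral_const, measureReal_def,
    volume_Ioc_two_pi, ENNReal.toReal_ofReal Real.two_pi_pos.le, smul_eq_mul]
  have hwu : Real.log ‖w‖ = Real.log ‖b‖ + Real.log ‖u‖ := by
    rw [← Real.log_mul (norm_ne_zero_iff.2 hb) (norm_ne_zero_iff.2 hu), ← norm_mul,
      mul_div_cancel₀ _ hb, norm_neg]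
  rw [sub_div, mul_div_cancel_left₀ _ Real.two_pi_pos.ne', div_eq_inv_mul, havg]
  linarith

lemma mean_potGap_le {x c : ℕ → ℝ} {L t : ℝ} (ht : 0 < t) (a b : ℂ)
    (h : ∀ (k : ℕ) (θ : ℝ),
      ‖a + ((t : ℂ) * Complex.exp (θ * Complex.I)) • b - (x k : ℂ)‖ ≤ Real.exp L) :
    (∫⁻ θ : ℝ in Ioc 0 (2 * Real.pi),
      potGap x c L (a + ((t : ℂ) * Complex.exp (θ * Complex.I)) • b))
        / ENNReal.ofReal (2 * Real.pi) ≤ potGap x c L a := by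
  have hm : ∀ k, Measurable fun θ : ℝ =>
      logGap L (a + ((t : ℂ) * Complex.exp (θ * Complex.I)) • b - (x k : ℂ)) := fun k =>
    ((continuous_logGap L).comp (by fun_prop)).measurable
  simp only [potGap]
  rw [lintegral_tsum fun k => ((hm k).const_mul _).aemeasurable, div_eq_mul_inv,
    ← ENNReal.tsum_mul_right]
  refine ENNReal.tsum_le_tsum fun k => ?_
  rw [lintegral_const_mul _ (hm k), mul_assoc, ← div_eq_mul_inv]
  gcongr
  have e : ∀ θ : ℝ, a + ((t : ℂ) * Complex.exp (θ * Complex.I)) • b - (x k : ℂ)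
      = a - (x k : ℂ) + ((t : ℂ) * Complex.exp (θ * Complex.I)) • b := fun θ => by ring
  simp_rw [e]
  exact mean_logGap_le ht _ _ fun θ => by rw [← e]; exact h k θ

/-- A convergent logarithmic potential with poles in `(0,1)` is subharmonic on `ℂ`. -/
lemma isPSHOn_lam {x c : ℕ → ℝ} (hx : ∀ k, x k ∈ Ioo (0 : ℝ) 1) (hc : ∀ k, 0 < c k)
    (hs : Summable c) : IsPSHOn (lam x c) univ := by
  have hn : ∀ (z : ℂ) (k : ℕ), ‖z - (x k : ℂ)‖ ≤ ‖z‖ + 1 := fun z k =>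
    (norm_sub_le _ _).trans (by
      rw [Complex.norm_real, Real.norm_of_nonneg (hx k).1.le]
      linarith [(hx k).2])
  -- The poles lie in `(0,1)`, so `L = log (R + 1)` serves all `k` at once; it is also non-negative,
  -- as `le_circleMean_coe_sub_coe` needs for the constant.
  have heq : ∀ (R : ℝ) (z : ℂ), ‖z‖ ≤ R → lam x c z
      = ((∑' k, c k * Real.log (R + 1) : ℝ) : EReal) - (potGap x c (Real.log (R + 1)) z : EReal) :=
    fun R z hz => lam_eq hc hs fun k => by
      rw [Real.exp_log (by linarith [norm_nonneg z])]
      linarith [hn z k]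
  refine ⟨fun z _ => ?_, fun z _ => ?_, fun a _ b => ⟨1, one_pos, fun t ht ht1 => ?_⟩⟩
  · have hev : ∀ᶠ y in 𝓝 z, ‖y‖ ≤ ‖z‖ + 1 :=
      (continuous_norm.tendsto z).eventually_le_const (lt_add_one _)
    have husc := (continuous_coe_sub_coe
      (∑' k, c k * Real.log (‖z‖ + 1 + 1))).comp_lowerSemicontinuous_antitone
      (lowerSemicontinuous_potGap x c (Real.log (‖z‖ + 1 + 1)))
      (antitone_coe_sub_coe _)
    refine UpperSemicontinuousAt.upperSemicontinuousWithinAt _ fun y hy => ?_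
    dsimp only at hy ⊢
    rw [heq (‖z‖ + 1) z (by linarith)] at hy
    filter_upwards [hev, husc z y hy] with v hv hvy
    rw [heq _ v hv]
    exact hvy
  · rw [heq _ z le_rfl, sub_eq_add_neg]
    exact EReal.add_lt_top (EReal.coe_ne_top _) (by simp)
  · have hle : ∀ θ : ℝ, ‖a + ((t : ℂ) * Complex.exp (θ * Complex.I)) • b‖ ≤ ‖a‖ + ‖b‖ := fun θ => by
      refine (norm_add_le _ _).trans ?_
      rw [norm_smul, norm_mul, Complex.norm_exp_ofReal_mul_I, mul_one, Complex.norm_real,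
        Real.norm_of_nonneg ht.le]
      nlinarith [norm_nonneg b]
    simp_rw [heq (‖a‖ + ‖b‖) _ (hle _)]
    rw [heq (‖a‖ + ‖b‖) a (by linarith [norm_nonneg b])]
    refine le_circleMean_coe_sub_coe (tsum_nonneg fun k => ?_) ?_ (mean_potGap_le ht a b ?_)
    · exact mul_nonneg (hc k).le (Real.log_nonneg (by linarith [norm_nonneg a, norm_nonneg b]))
    · exact (lowerSemicontinuous_potGap _ _ _).measurable.comp
        (Continuous.measurable (by fun_prop))
    · intro k θ
      rw [Real.exp_log (by linarith [norm_nonneg a, norm_nonneg b])]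
      exact (hn _ k).trans (by linarith [hle θ])

/-! ### Existence of the points, coefficients and radii -/

lemma exists_isPoints : ∃ x : ℕ → ℝ, IsPoints x := by
  -- Unpairing `n` makes `y` visit each point of `A` infinitely often. Moving left by less than the
  -- gap `g` to the next point of `A` keeps the sequence off `A`, and the factor `1 / (n + 2)` makes
  -- the displacement vanish in the limit.
  let y : ℕ → ℝ := fun n => 1 / ((n.unpair.1 : ℝ) + 1)
  let g : ℕ → ℝ := fun n => 1 / ((n.unpair.1 : ℝ) + 1) - 1 / ((n.unpair.1 : ℝ) + 2)
  have hg0 : ∀ n, 0 < g n := fun n => sub_pos.2 (by gcongr; norm_num)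
  have hg1 : ∀ n, g n ≤ 1 := fun n => by
    have h1 : 1 / ((n.unpair.1 : ℝ) + 1) ≤ 1 := (div_le_one (by positivity)).2 (by simp)
    have h2 : 0 < 1 / ((n.unpair.1 : ℝ) + 2) := by positivity
    linarith
  have hq : ∀ n, 0 < g n / ((n : ℝ) + 2) ∧ g n / ((n : ℝ) + 2) < g n := fun n =>
    ⟨div_pos (hg0 n) (by positivity), div_lt_self (hg0 n) (by linarith [n.cast_nonneg (α := ℝ)])⟩
  have hyA : ∀ n, y n ∈ setA := fun n => ⟨n.unpair.1 + 1, by omega, by simp [y]⟩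
  have hlim : Tendsto (fun n => g n / ((n : ℝ) + 2)) atTop (𝓝 0) := by
    refine squeeze_zero (fun n => (hq n).1.le) (fun n => ?_)
      tendsto_one_div_add_atTop_nhds_zero_nat
    exact div_le_div₀ zero_le_one (hg1 n) (by positivity) (by linarith)
  refine ⟨fun n => y n - g n / ((n : ℝ) + 2), fun n => ⟨⟨?_, ?_⟩, ?_⟩, ?_⟩
  · have : 0 < 1 / ((n.unpair.1 : ℝ) + 2) := by positivity
    have h2 := (hq n).2
    simp only [g] at h2
    simp only [y, g]
    linarith
  · have h1 : 1 / ((n.unpair.1 : ℝ) + 1) ≤ 1 := (div_le_one (by positivity)).2 (by simp)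
    simp only [y]
    linarith [(hq n).1]
  · rintro ⟨j, hj, he⟩
    have hj' : (0 : ℝ) < j := by exact_mod_cast hj
    have h1 : 1 / (j : ℝ) < 1 / ((n.unpair.1 : ℝ) + 1) := by
      have := (hq n).1
      simp only [y] at he
      linarith
    have h2 : 1 / ((n.unpair.1 : ℝ) + 2) < 1 / (j : ℝ) := by
      have := (hq n).2
      simp only [y, g] at he this
      linarith
    rw [one_div_lt_one_div hj' (by positivity)] at h1
    rw [one_div_lt_one_div (by positivity) hj'] at h2
    norm_cast at h1 h2
    omega
  · refine Subset.antisymm (fun a ha => ?_) ?_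
    · refine Metric.mem_closure_iff.2 fun ε hε => ?_
      have h1 := mapClusterPt_iff_frequently.1 ha _ (Metric.ball_mem_nhds a (half_pos hε))
      have h2 := hlim.eventually_lt_const (half_pos hε)
      obtain ⟨n, hn1, hn2⟩ := (h1.and_eventually h2).exists
      refine ⟨y n, hyA n, ?_⟩
      rw [Metric.mem_ball, Real.dist_eq, abs_lt] at hn1
      rw [Real.dist_eq, abs_lt]
      constructor <;> linarith [(hq n).1]
    · refine closure_minimal ?_ isClosed_setOfPred_clusterPt
      rintro a ⟨j, hj, rfl⟩
      have ht : Tendsto (fun i => Nat.pair (j - 1) i) atTop atTop :=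
        tendsto_atTop_mono (fun i => Nat.right_le_pair _ _) tendsto_id
      refine MapClusterPt.of_comp ht (Tendsto.mapClusterPt ?_)
      have hy : ∀ i, y (Nat.pair (j - 1) i) = 1 / (j : ℝ) := fun i => by
        simp only [y, Nat.unpair_pair]
        push_cast [Nat.cast_sub hj]
        ring_nf
      have := (tendsto_const_nhds (x := 1 / (j : ℝ))).sub (hlim.comp ht)
      simpa [Function.comp_def, hy] using this

lemma isClosed_insert_zero_setA : IsClosed (insert 0 setA) := by
  have h : setA = range fun n : ℕ => 1 / ((n : ℝ) + 1) := by
    ext a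
    constructor
    · rintro ⟨k, hk, rfl⟩
      exact ⟨k - 1, by simp [Nat.cast_sub hk]⟩
    · rintro ⟨n, rfl⟩
      exact ⟨n + 1, by omega, by simp⟩
  rw [h]
  exact tendsto_one_div_add_atTop_nhds_zero_nat.isCompact_insert_range.isClosed

lemma exists_le_abs_sub {x : ℝ} (hx : x ∈ Ioo (0 : ℝ) 1 \ setA) :
    ∃ d, 0 < d ∧ ∀ a ∈ setA, d ≤ |a - x| := by
  have hx' : x ∉ insert 0 setA := by
    rintro (h | h)
    · exact hx.1.1.ne' h
    · exact hx.2 h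
  refine ⟨_, (isClosed_insert_zero_setA.notMem_iff_infDist_pos (insert_nonempty _ _)).1 hx',
    fun a ha => ?_⟩
  rw [abs_sub_comm, ← Real.dist_eq]
  exact Metric.infDist_le_dist_of_mem (mem_insert_of_mem _ ha)

lemma exists_isCoeffs {x : ℕ → ℝ} (hx : IsPoints x) : ∃ c : ℕ → ℝ, IsCoeffs x c := by
  choose d hd0 hd using fun k => exists_le_abs_sub (hx.mem k)
  -- `S` dominates `|log d_k|`, so `c_k |log d_k| ≤ e_k`; partial sums are used to make it monotone,
  -- whence `c = e / S` is antitone.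
  let S : ℕ → ℝ := fun k => 1 + ∑ i ∈ Finset.range (k + 1), |Real.log (d i)|
  have hS1 : ∀ k, 1 ≤ S k := fun k =>
    le_add_of_nonneg_right (Finset.sum_nonneg fun i _ => abs_nonneg _)
  have hSlog : ∀ k, |Real.log (d k)| ≤ S k := fun k =>
    (Finset.single_le_sum (f := fun i => |Real.log (d i)|) (fun i _ => abs_nonneg _)
      (Finset.self_mem_range_succ k)).trans (by simp [S])
  have hSmono : Monotone S := monotone_nat_of_le_succ fun k => by
    simp only [S]
    rw [Finset.sum_range_succ _ (k + 1)]
    linarith [abs_nonneg (Real.log (d (k + 1)))]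
  -- Normalised so that `∑ e_k = 1/2`, the bound required on `A`.
  let e : ℕ → ℝ := fun k => 1 / 2 / 2 / 2 ^ k
  have he0 : ∀ k, 0 < e k := fun k => by positivity
  have hes : Summable e := summable_geometric_two' (1 / 2)
  let c : ℕ → ℝ := fun k => e k / S k
  have hc0 : ∀ k, 0 < c k := fun k => div_pos (he0 k) (by linarith [hS1 k])
  have hce : ∀ k, c k ≤ e k := fun k => div_le_self (he0 k).le (hS1 k)
  have hcs : Summable c := Summable.of_nonneg_of_le (fun k => (hc0 k).le) hce hes
  refine ⟨c, hc0, fun i j hij => ?_, hcs.tendsto_atTop_zero,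
    isPSHOn_lam (fun k => (hx.mem k).1) hc0 hcs, fun a ha => ?_⟩
  · refine div_le_div₀ (he0 i).le ?_ (by linarith [hS1 i]) (hSmono hij)
    simp only [e]
    gcongr
    norm_num
  · have ha01 : 0 < a ∧ a ≤ 1 := by
      obtain ⟨k, hk, rfl⟩ := ha
      exact ⟨by positivity, (div_le_one (by positivity)).2 (by exact_mod_cast hk)⟩
    have hnorm : ∀ k, ‖(a : ℂ) - (x k : ℂ)‖ = |a - x k| := fun k => by
      rw [← Complex.ofReal_sub, Complex.norm_real, Real.norm_eq_abs]
    rw [lam_eq (L := 0) hc0 hcs fun k => ?_]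
    · have hp : potGap x c 0 (a : ℂ) ≤ ENNReal.ofReal (1 / 2) := by
        calc potGap x c 0 (a : ℂ) ≤ ∑' k, ENNReal.ofReal (e k) := by
              refine ENNReal.tsum_le_tsum fun k => ?_
              have hpos : 0 < |a - x k| := (hd0 k).trans_le (hd k a ha)
              rw [logGap_of_ne_zero _ (norm_pos_iff.1 (by rw [hnorm]; exact hpos)), hnorm,
                ← ENNReal.ofReal_mul (hc0 k).le]
              refine ENNReal.ofReal_le_ofReal ?_
              have h1 : Real.log (d k) ≤ Real.log |a - x k| := Real.log_le_log (hd0 k) (hd k a ha)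
              have h2 : 0 - Real.log |a - x k| ≤ S k := by
                linarith [neg_abs_le (Real.log (d k)), hSlog k]
              calc c k * (0 - Real.log |a - x k|) ≤ c k * S k :=
                    mul_le_mul_of_nonneg_left h2 (hc0 k).le
                _ = e k := div_mul_cancel₀ _ (by linarith [hS1 k])
          _ = ENNReal.ofReal (∑' k, e k) :=
              (ENNReal.ofReal_tsum_of_nonneg (fun k => (he0 k).le) hes).symm
          _ = ENNReal.ofReal (1 / 2) := by rw [tsum_geometric_two' (1 / 2)]
      refine le_trans ?_ (antitone_coe_sub_coe _ hp)
      dsimp only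
      rw [EReal.coe_ennreal_ofReal, max_eq_left (by norm_num), ← EReal.coe_sub,
        EReal.coe_le_coe_iff]
      simp
      norm_num
    · rw [hnorm, Real.exp_zero, abs_le]
      constructor <;> linarith [(hx.mem k).1.1, (hx.mem k).1.2]

/-- `⊥` absorbs addition in `EReal`, so every partial sum over a finite set containing `k` is `⊥`;
summability of `c` plays no role. -/
lemma lam_pole {x c : ℕ → ℝ} (hc : ∀ k, 0 < c k) (k : ℕ) : lam x c (x k : ℂ) = ⊥ := by
  have : HasSum (fun i => (c i : EReal) * ENNReal.log ‖(x k : ℂ) - (x i : ℂ)‖ₑ) ⊥ := by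
    refine tendsto_const_nhds.congr' ?_
    filter_upwards [eventually_ge_atTop {k}] with s hs
    rw [← Finset.add_sum_erase s _ (hs (Finset.mem_singleton_self k))]
    simp [EReal.coe_mul_bot_of_pos (hc k)]
  exact this.tsum_eq

lemma exists_isRadii {x c : ℕ → ℝ} (hc : IsCoeffs x c) : ∃ r : ℕ → ℝ, IsRadii x c r := by
  have h : ∀ k, ∃ r : ℝ, 0 < r ∧ ∀ z ∈ Metric.ball (x k : ℂ) r, lam x c z < -1 := fun k => by
    have := hc.subharmonic.usc (x k : ℂ) (mem_univ _) (-1)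
      (by dsimp only; rw [lam_pole hc.pos]; exact EReal.bot_lt_coe (-1))
    rw [nhdsWithin_univ] at this
    exact Metric.eventually_nhds_iff_ball.1 this
  choose r hr0 hr using h
  exact ⟨r, hr0, hr⟩

/-! ### Plurisubharmonicity as a local property -/

lemma circleMean_coe {f : ℝ → ℝ} (hf : IntegrableOn f (Ioc 0 (2 * Real.pi))) :
    circleMean (fun θ => (f θ : EReal))
      = (((∫ θ in Ioc 0 (2 * Real.pi), f θ) / (2 * Real.pi) : ℝ) : EReal) := by
  have aux : ∀ P : ENNReal, P ≠ ⊤ → ((P / ENNReal.ofReal (2 * Real.pi) : ENNReal) : EReal)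
      = ((P.toReal / (2 * Real.pi) : ℝ) : EReal) := fun P hP => by
    rw [← EReal.coe_ennreal_toReal (ENNReal.div_ne_top hP ofReal_two_pi_ne_zero),
      ENNReal.toReal_div, ENNReal.toReal_ofReal Real.two_pi_pos.le]
  simp only [circleMean, ← EReal.coe_neg, EReal.real_coe_toENNReal]
  rw [aux _ hf.lintegral_lt_top.ne,
    aux (∫⁻ θ in Ioc 0 (2 * Real.pi), ENNReal.ofReal (-f θ))
      (Integrable.lintegral_lt_top hf.neg).ne,
    integral_eq_lintegral_pos_part_sub_lintegral_neg_part hf, sub_div, EReal.coe_sub]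

lemma IsPSHOn.mono {E : Type*} [NormedAddCommGroup E] [NormedSpace ℂ E] {u : E → EReal}
    {D D' : Set E} (h : IsPSHOn u D) (hD : D' ⊆ D) : IsPSHOn u D' :=
  ⟨h.usc.mono hD, fun a ha => h.lt_top a (hD ha), fun a ha => h.submean a (hD ha)⟩

lemma norm_mul_exp_smul {E : Type*} [NormedAddCommGroup E] [NormedSpace ℂ E] {t : ℝ} (ht : 0 ≤ t)
    (θ : ℝ) (b : E) : ‖((t : ℂ) * Complex.exp (θ * Complex.I)) • b‖ = t * ‖b‖ := by
  rw [norm_smul, norm_mul, Complex.norm_exp_ofReal_mul_I, mul_one, Complex.norm_real,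
    Real.norm_of_nonneg ht]

lemma exists_forall_circle_mem {E : Type*} [NormedAddCommGroup E] [NormedSpace ℂ E] {a : E}
    {s : Set E} (hs : s ∈ 𝓝 a) (b : E) : ∃ ρ : ℝ, 0 < ρ ∧ ∀ t : ℝ, 0 < t → t < ρ → ∀ θ : ℝ,
      a + ((t : ℂ) * Complex.exp (θ * Complex.I)) • b ∈ s := by
  obtain ⟨ε, hε, hball⟩ := Metric.mem_nhds_iff.1 hs
  refine ⟨ε / (‖b‖ + 1), by positivity, fun t ht htρ θ => hball ?_⟩
  rw [mem_ball_iff_norm, add_sub_cancel_left, norm_mul_exp_smul ht.le]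
  rw [lt_div_iff₀ (by positivity)] at htρ
  linarith

lemma isPSHOn_of_eventuallyEq {E : Type*} [NormedAddCommGroup E] [NormedSpace ℂ E] {u : E → EReal}
    {D : Set E} (h : ∀ a ∈ D, ∃ w, IsPSHOn w univ ∧ u =ᶠ[𝓝 a] w) : IsPSHOn u D := by
  refine ⟨fun a ha y hy => ?_, fun a ha => ?_, fun a ha b => ?_⟩ <;>
    obtain ⟨w, hw, he⟩ := h a ha
  · dsimp only at hy ⊢
    rw [he.self_of_nhds] at hy
    have := hw.usc a (mem_univ a) y hy
    rw [nhdsWithin_univ] at this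
    refine nhdsWithin_le_nhds ?_
    filter_upwards [this, he] with z hz1 hz2
    rw [hz2]
    exact hz1
  · rw [he.self_of_nhds]
    exact hw.lt_top a (mem_univ a)
  · obtain ⟨ρ₁, hρ₁, h₁⟩ := exists_forall_circle_mem he b
    obtain ⟨ρ₂, hρ₂, h₂⟩ := hw.submean a (mem_univ a) b
    refine ⟨min ρ₁ ρ₂, lt_min hρ₁ hρ₂, fun t ht htρ => ?_⟩
    rw [he.self_of_nhds, funext fun θ => h₁ t ht (htρ.trans_le (min_le_left _ _)) θ]
    exact h₂ t ht (htρ.trans_le (min_le_right _ _))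

lemma neg_one_le_circleMean : (-1 : EReal) ≤ circleMean (fun _ => -1) := by
  have := circleMean_coe (f := fun _ => -1)
    (integrableOn_const measure_Ioc_lt_top.ne)
  rw [setIntegral_const, measureReal_def, volume_Ioc_two_pi,
    ENNReal.toReal_ofReal Real.two_pi_pos.le, smul_eq_mul,
    mul_div_cancel_left₀ _ Real.two_pi_pos.ne'] at this
  exact this.ge

lemma isPSHOn_neg_one {E : Type*} [NormedAddCommGroup E] [NormedSpace ℂ E] :
    IsPSHOn (fun _ : E => (-1 : EReal)) univ :=
  ⟨upperSemicontinuous_const.upperSemicontinuousOn _, fun _ _ => EReal.coe_lt_top (-1),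
    fun _ _ _ => ⟨1, one_pos, fun _ _ _ => neg_one_le_circleMean⟩⟩

lemma continuous_fstPart {m : ℕ} : Continuous (fstPart (m := m)) := by
  unfold fstPart
  fun_prop

lemma continuous_lastPart {m : ℕ} : Continuous (lastPart (m := m)) := by
  unfold lastPart
  fun_prop

lemma isPSHOn_max_lam {x c : ℕ → ℝ} (h : IsPSHOn (lam x c) univ) (m : ℕ) :
    IsPSHOn (fun z : Cn (m + 1) => max (lam x c (lastPart z)) (-1)) univ := by
  refine ⟨fun a _ y hy => ?_, fun a _ => ?_, fun a _ b => ?_⟩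
  · rw [nhdsWithin_univ]
    obtain ⟨h1, h2⟩ := max_lt_iff.1 hy
    have := h.usc (lastPart a) (mem_univ _) y h1
    rw [nhdsWithin_univ] at this
    filter_upwards [continuous_lastPart.continuousAt this] with z hz
    exact max_lt hz h2
  · exact max_lt (h.lt_top _ (mem_univ _)) (EReal.coe_lt_top (-1))
  · obtain ⟨ρ, hρ, hm⟩ := h.submean (lastPart a) (mem_univ _) (lastPart b)
    refine ⟨ρ, hρ, fun t ht htρ => max_le ((hm t ht htρ).trans ?_)
      (neg_one_le_circleMean.trans (circleMean_mono fun θ => le_max_right _ _))⟩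
    exact circleMean_mono fun θ => le_max_left (lam x c _) _

/-! ### The domain `Ω`: gluing, the boundary point, connectedness -/

section Domain

variable {m : ℕ} {x c r : ℕ → ℝ}

lemma eventually_of_mem_Omega {z : Cn (m + 1)} (hz : z ∈ Omega m x r) (hr : IsRadii x c r) :
    (∀ᶠ w in 𝓝 z, ‖fstPart w‖ < ‖lastPart w‖) ∨ (∀ᶠ w in 𝓝 z, ¬‖fstPart w‖ < ‖lastPart w‖) ∨
      ∀ᶠ w in 𝓝 z, lam x c (lastPart w) < -1 := by
  have h1 : Continuous fun w : Cn (m + 1) => ‖fstPart w‖ := continuous_fstPart.norm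
  have h2 : Continuous fun w : Cn (m + 1) => ‖lastPart w‖ := continuous_lastPart.norm
  rcases lt_trichotomy ‖fstPart z‖ ‖lastPart z‖ with h | h | h
  · exact Or.inl ((isOpen_lt h1 h2).mem_nhds h)
  · refine Or.inr (Or.inr ?_)
    have hD : lastPart z ∈ ⋃ k, Metric.ball (x k : ℂ) (r k) := by
      by_contra hD
      exact hz.2 ⟨h, hD⟩
    obtain ⟨k, hk⟩ := mem_iUnion.1 hD
    filter_upwards [continuous_lastPart.continuousAt (Metric.isOpen_ball.mem_nhds hk)] with w hw
    exact hr.lt_on_disc k _ hw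
  · refine Or.inr (Or.inl ?_)
    filter_upwards [(isOpen_lt h2 h1).mem_nhds h] with w hw
    exact not_lt.2 (le_of_lt hw)

lemma isPSHOn_exampleFun (hc : IsPSHOn (lam x c) univ) (hr : IsRadii x c r) :
    IsPSHOn (exampleFun m x c) (Omega m x r) := by
  refine isPSHOn_of_eventuallyEq fun a ha => ?_
  rcases eventually_of_mem_Omega ha hr with h | h | h
  · exact ⟨_, isPSHOn_neg_one, h.mono fun w hw => if_pos hw⟩
  · exact ⟨_, isPSHOn_max_lam hc m, h.mono fun w hw => if_neg hw⟩
  · exact ⟨_, isPSHOn_neg_one, h.mono fun w hw => by simp [exampleFun, max_eq_right hw.le]⟩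

lemma isPSHOn_exampleFunSwap (hc : IsPSHOn (lam x c) univ) (hr : IsRadii x c r) :
    IsPSHOn (exampleFunSwap m x c) (Omega m x r) := by
  refine isPSHOn_of_eventuallyEq fun a ha => ?_
  rcases eventually_of_mem_Omega ha hr with h | h | h
  · exact ⟨_, isPSHOn_max_lam hc m, h.mono fun w hw => if_pos hw⟩
  · exact ⟨_, isPSHOn_neg_one, h.mono fun w hw => if_neg hw⟩
  · exact ⟨_, isPSHOn_neg_one, h.mono fun w hw => by simp [exampleFunSwap, max_eq_right hw.le]⟩

lemma isOpen_Omega : IsOpen (Omega m x r) := by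
  have h1 : Continuous fun w : Cn (m + 1) => ‖fstPart w‖ := continuous_fstPart.norm
  have h2 : Continuous fun w : Cn (m + 1) => ‖lastPart w‖ := continuous_lastPart.norm
  refine (isOpen_lt ((h1.pow 2).add ((continuous_lastPart.sub continuous_const).norm.pow 2))
    continuous_const).sdiff ((isClosed_eq h1 h2).inter ?_)
  exact (isOpen_iUnion fun k => Metric.isOpen_ball).isClosed_compl.preimage continuous_lastPart

/-- The point `(v, w)` of `ℂ^m × ℂ = ℂ^(m+1)`. -/
def joinPt (v : Cn m) (w : ℂ) : Cn (m + 1) :=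
  WithLp.toLp 2 (Fin.snoc (α := fun _ => ℂ) (fun i => v i) w)

@[simp] lemma fstPart_joinPt (v : Cn m) (w : ℂ) : fstPart (joinPt v w) = v := by
  ext i
  simp [fstPart, joinPt]

@[simp] lemma lastPart_joinPt (v : Cn m) (w : ℂ) : lastPart (joinPt v w) = w := by
  simp [lastPart, joinPt]

lemma joinPt_fstPart_lastPart (z : Cn (m + 1)) : joinPt (fstPart z) (lastPart z) = z := by
  ext i
  refine Fin.lastCases ?_ (fun j => ?_) i
  · simp [joinPt, lastPart]
  · simp [joinPt, fstPart]

lemma continuous_joinPt : Continuous fun p : Cn m × ℂ => joinPt p.1 p.2 := by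
  refine (PiLp.continuous_toLp 2 _).comp (continuous_pi fun i => ?_)
  refine Fin.lastCases ?_ (fun j => ?_) i
  · simpa using continuous_snd
  · simp only [Fin.snoc_castSucc]
    fun_prop

lemma joinPt_mem_Omega {v : Cn m} {w : ℂ} (h1 : ‖v‖ ^ 2 + ‖w - 1‖ ^ 2 < 1)
    (h2 : ‖v‖ = ‖w‖ → ∃ k, w ∈ Metric.ball (x k : ℂ) (r k)) : joinPt v w ∈ Omega m x r := by
  refine ⟨by simpa using h1, fun h => ?_⟩
  simp only [setK, fstPart_joinPt, lastPart_joinPt, mem_ofPred_eq] at h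
  exact h.2 (mem_iUnion.2 (h2 h.1))

lemma zero_mem_frontier_Omega : (0 : Cn (m + 1)) ∈ frontier (Omega m x r) := by
  have h0 : (0 : Cn (m + 1)) = joinPt 0 0 := by
    rw [← joinPt_fstPart_lastPart (0 : Cn (m + 1))]
    rfl
  rw [isOpen_Omega.frontier_eq]
  constructor
  · have ht : Tendsto (fun n : ℕ => joinPt (0 : Cn m) (((1 / ((n : ℝ) + 1) : ℝ)) : ℂ)) atTop
        (𝓝 0) := by
      rw [h0]
      refine ((continuous_joinPt (m := m)).tendsto (0, 0)).comp (tendsto_const_nhds.prodMk_nhds ?_)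
      exact (Complex.continuous_ofReal.tendsto' 0 0 rfl).comp
        tendsto_one_div_add_atTop_nhds_zero_nat
    refine mem_closure_of_tendsto ht (Eventually.of_forall fun n => joinPt_mem_Omega ?_ ?_)
    · have h1 : 0 < 1 / ((n : ℝ) + 1) := by positivity
      have h2 : 1 / ((n : ℝ) + 1) ≤ 1 := (div_le_one (by positivity)).2 (by simp)
      rw [← Complex.ofReal_one, ← Complex.ofReal_sub, Complex.norm_real, Real.norm_eq_abs, sq_abs,
        norm_zero]
      nlinarith
    · intro h
      rw [norm_zero, Complex.norm_real, eq_comm, norm_eq_zero] at h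
      exact absurd h (by positivity)
  · intro h
    have := h.1
    rw [h0] at this
    simp at this

/-- Polar coordinates: the set is the image of `(0,1)` times the unit sphere, which is path
connected since the real dimension `2m` exceeds `1`. -/
lemma isPathConnected_punctured_ball (hm : 1 ≤ m) :
    IsPathConnected {v : Cn m | 0 < ‖v‖ ∧ ‖v‖ < 1} := by
  have hrank : 1 < Module.rank ℝ (Cn m) := by
    rw [rank_real_of_complex, rank_eq_card_basis (EuclideanSpace.basisFun (Fin m) ℂ).toBasis,
      Fintype.card_fin]
    norm_cast
    omega
  have h := ((convex_Ioo (0 : ℝ) 1).isPathConnected ⟨1 / 2, by norm_num⟩).prod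
    (isPathConnected_sphere hrank (0 : Cn m) zero_le_one)
  convert h.image (f := fun p : ℝ × Cn m => p.1 • p.2) (by fun_prop) using 1
  ext v
  constructor
  · rintro ⟨h0, h1⟩
    refine ⟨(‖v‖, ‖v‖⁻¹ • v), ⟨⟨h0, h1⟩, ?_⟩, ?_⟩
    · rw [mem_sphere_zero_iff_norm, norm_smul, norm_inv, norm_norm, inv_mul_cancel₀ h0.ne']
    · simp [smul_smul, mul_inv_cancel₀ h0.ne']
  · rintro ⟨⟨s, w⟩, ⟨hs, hw⟩, rfl⟩
    rw [mem_sphere_zero_iff_norm] at hw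
    simp only [mem_ofPred_eq, norm_smul, hw, mul_one, Real.norm_of_nonneg hs.1.le]
    exact hs

/-- Shrinking `v` to `0` makes `|z'| < |z_n|` at once, and the segment from `w` to `1` stays in
`|z_n - 1| < 1`, which excludes `z_n = 0`; so the path avoids the cone after its starting point. -/
lemma joinedIn_Omega_of_le {v : Cn m} {w : ℂ} (h : joinPt v w ∈ Omega m x r) (hle : ‖v‖ ≤ ‖w‖) :
    JoinedIn (Omega m x r) (joinPt v w) (joinPt 0 1) := by
  have hball : ‖v‖ ^ 2 + ‖w - 1‖ ^ 2 < 1 := by simpa using h.1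
  have hne : ∀ u : ℂ, ‖u - 1‖ ^ 2 < 1 → 0 < ‖u‖ := fun u hu => by
    rw [norm_pos_iff]
    rintro rfl
    simp at hu
  have hw : 0 < ‖w‖ := hne w (by nlinarith [sq_nonneg ‖v‖])
  refine JoinedIn.trans (y := joinPt 0 w) ?_ ?_
  · refine JoinedIn.ofLine (f := fun s => joinPt ((1 - s) • v) w)
      (continuous_joinPt.comp (by fun_prop :
        Continuous fun s : ℝ => ((1 - s) • v, w))).continuousOn (by simp) (by simp) ?_
    rintro _ ⟨s, hs, rfl⟩
    have hn : ‖(1 - s) • v‖ = (1 - s) * ‖v‖ := by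
      rw [norm_smul, Real.norm_of_nonneg (by linarith [hs.2])]
    rcases hs.1.eq_or_lt with rfl | hs0
    · simpa using h
    refine joinPt_mem_Omega (lt_of_le_of_lt ?_ hball) fun he => ?_
    · gcongr
      rw [hn]
      nlinarith [norm_nonneg v]
    · rw [hn] at he
      nlinarith [mul_le_mul_of_nonneg_left hle (sub_nonneg.2 hs.2), mul_pos hs0 hw]
  · refine JoinedIn.ofLine (f := fun s => joinPt 0 (w + s * (1 - w)))
      (continuous_joinPt.comp (by fun_prop :
        Continuous fun s : ℝ => ((0 : Cn m), w + s * (1 - w)))).continuousOn (by simp) (by simp) ?_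
    rintro _ ⟨s, hs, rfl⟩
    have hn : ‖w + s * (1 - w) - 1‖ = (1 - s) * ‖w - 1‖ := by
      rw [show w + s * (1 - w) - 1 = ((1 - s : ℝ) : ℂ) * (w - 1) by push_cast; ring, norm_mul,
        Complex.norm_real, Real.norm_of_nonneg (by linarith [hs.2])]
    have hlt : ‖w + s * (1 - w) - 1‖ ^ 2 < 1 := by
      refine lt_of_le_of_lt ?_ (lt_of_le_of_lt (le_add_of_nonneg_left (sq_nonneg ‖v‖)) hball)
      gcongr
      rw [hn]
      nlinarith [norm_nonneg (w - 1), hs.1]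
    refine joinPt_mem_Omega (by simpa using hlt) fun he => ?_
    rw [norm_zero] at he
    exact absurd he (hne _ hlt).ne

lemma norm_ofReal_sub_one_sq (s : ℝ) : ‖(s : ℂ) - 1‖ ^ 2 = (s - 1) ^ 2 := by
  rw [← Complex.ofReal_one, ← Complex.ofReal_sub, Complex.norm_real, Real.norm_eq_abs, sq_abs]

/-- For fixed `v` the admissible `z_n` with `|z_n| < |v|` form an intersection of two discs, a
convex set; `|v|²` is a point of it depending continuously on `v`. -/
lemma joinedIn_Omega_of_lt {v : Cn m} {w : ℂ} (h : joinPt v w ∈ Omega m x r) (hlt : ‖w‖ < ‖v‖) :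
    JoinedIn (Omega m x r) (joinPt v w) (joinPt v ((‖v‖ ^ 2 : ℝ) : ℂ)) := by
  have hball : ‖v‖ ^ 2 + ‖w - 1‖ ^ 2 < 1 := by simpa using h.1
  have hv0 : 0 < ‖v‖ := (norm_nonneg w).trans_lt hlt
  have hv1 : ‖v‖ ^ 2 < 1 := by nlinarith [sq_nonneg ‖w - 1‖]
  have hv1' : ‖v‖ < 1 := by nlinarith
  have hconv : Convex ℝ (Metric.ball (0 : ℂ) ‖v‖ ∩ Metric.ball (1 : ℂ) (Real.sqrt (1 - ‖v‖ ^ 2))) :=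
    (convex_ball _ _).inter (convex_ball _ _)
  have hmem : ∀ u : ℂ, u ∈ Metric.ball (0 : ℂ) ‖v‖ ∩ Metric.ball (1 : ℂ) (Real.sqrt (1 - ‖v‖ ^ 2)) ↔
      ‖u‖ < ‖v‖ ∧ ‖v‖ ^ 2 + ‖u - 1‖ ^ 2 < 1 := fun u => by
    rw [mem_inter_iff, mem_ball_zero_iff, mem_ball_iff_norm, Real.lt_sqrt (norm_nonneg _),
      lt_sub_iff_add_lt']
  have h1 := (hmem w).2 ⟨hlt, hball⟩
  have h2 := (hmem ((‖v‖ ^ 2 : ℝ) : ℂ)).2 ⟨by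
    rw [Complex.norm_real, Real.norm_of_nonneg (sq_nonneg _)]
    nlinarith, by
    rw [norm_ofReal_sub_one_sq]
    nlinarith [mul_pos hv0 hv0]⟩
  refine JoinedIn.ofLine (f := fun s => joinPt v (AffineMap.lineMap w ((‖v‖ ^ 2 : ℝ) : ℂ) s))
      (continuous_joinPt.comp (continuous_const.prodMk AffineMap.lineMap_continuous)).continuousOn
      (by simp) (by simp) ?_
  rintro _ ⟨s, hs, rfl⟩
  have h3 := (hmem _).1 (hconv.lineMap_mem h1 h2 hs)
  exact joinPt_mem_Omega h3.2 fun he => absurd he h3.1.ne'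

lemma isConnected_Omega (hm : 1 ≤ m) (hx : ∀ k, x k ∈ Ioo (0 : ℝ) 1) (hr : ∀ k, 0 < r k) :
    IsConnected (Omega m x r) := by
  have hg : ∀ v : Cn m, 0 < ‖v‖ → ‖v‖ < 1 → ∀ l : ℝ, ‖v‖ ^ 2 ≤ l → l < ‖v‖ →
      joinPt v (l : ℂ) ∈ Omega m x r := fun v h0 h1 l hl1 hl2 => by
    refine joinPt_mem_Omega ?_ fun he => ?_
    · rw [norm_ofReal_sub_one_sq]
      nlinarith [mul_pos h0 h0]
    · rw [Complex.norm_real, Real.norm_of_nonneg ((sq_nonneg _).trans hl1)] at he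
      exact absurd he hl2.ne'
  have hgp := (isPathConnected_punctured_ball hm).image
    (f := fun v : Cn m => joinPt v ((‖v‖ ^ 2 : ℝ) : ℂ))
    (continuous_joinPt.comp (by fun_prop :
      Continuous fun v : Cn m => (v, ((‖v‖ ^ 2 : ℝ) : ℂ))))
  have hsub : (fun v : Cn m => joinPt v ((‖v‖ ^ 2 : ℝ) : ℂ)) '' {v : Cn m | 0 < ‖v‖ ∧ ‖v‖ < 1}
      ⊆ Omega m x r := by
    rintro _ ⟨v, ⟨h0, h1⟩, rfl⟩
    exact hg v h0 h1 _ le_rfl (by nlinarith)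
  obtain ⟨hs0, hs1⟩ := hx 0
  -- A point of the cone over the centre of `D_0`: it lies in `Ω` and is the bridge between the
  -- regions on either side of the cone.
  let v₀ : Cn m := EuclideanSpace.single ⟨0, hm⟩ (x 0 : ℂ)
  have hv₀ : ‖v₀‖ = x 0 := by simp [v₀, abs_of_pos hs0]
  have hbridge : joinPt v₀ (x 0 : ℂ) ∈ Omega m x r := by
    refine joinPt_mem_Omega ?_ fun _ => ⟨0, Metric.mem_ball_self (hr 0)⟩
    rw [norm_ofReal_sub_one_sq, hv₀]
    nlinarith
  have hmain : JoinedIn (Omega m x r) (joinPt v₀ ((‖v₀‖ ^ 2 : ℝ) : ℂ)) (joinPt 0 1) := by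
    refine JoinedIn.trans (y := joinPt v₀ (x 0 : ℂ)) (JoinedIn.symm ?_)
      (joinedIn_Omega_of_le hbridge (by rw [hv₀, Complex.norm_real, Real.norm_of_nonneg hs0.le]))
    refine JoinedIn.ofLine
      (f := fun s => joinPt v₀ (((1 - s) * x 0 + s * ‖v₀‖ ^ 2 : ℝ) : ℂ))
      (continuous_joinPt.comp (by fun_prop : Continuous fun s : ℝ =>
        (v₀, (((1 - s) * x 0 + s * ‖v₀‖ ^ 2 : ℝ) : ℂ)))).continuousOn (by simp) (by simp) ?_
    rintro _ ⟨s, hs, rfl⟩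
    rcases hs.1.eq_or_lt with rfl | hs'
    · simpa using hbridge
    have hlt : x 0 ^ 2 < x 0 := by nlinarith
    refine hg v₀ (hv₀ ▸ hs0) (hv₀ ▸ hs1) _ ?_ ?_ <;> rw [hv₀] <;> nlinarith [hs.2]
  refine IsPathConnected.isConnected ⟨joinPt 0 1, hmain.target_mem, fun {z} hz => JoinedIn.symm ?_⟩
  rw [← joinPt_fstPart_lastPart z] at hz ⊢
  rcases le_or_gt ‖fstPart z‖ ‖lastPart z‖ with h | h
  · exact joinedIn_Omega_of_le hz h
  · refine (joinedIn_Omega_of_lt hz h).trans (JoinedIn.trans ?_ hmain)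
    have h0 : 0 < ‖fstPart z‖ := (norm_nonneg _).trans_lt h
    have h1 : ‖fstPart z‖ < 1 := by
      have : ‖fstPart z‖ ^ 2 + ‖lastPart z - 1‖ ^ 2 < 1 := by simpa using hz.1
      nlinarith [sq_nonneg ‖lastPart z - 1‖]
    exact (hgp.joinedIn _ ⟨_, ⟨h0, h1⟩, rfl⟩ _ ⟨v₀, ⟨hv₀ ▸ hs0, hv₀ ▸ hs1⟩, rfl⟩).mono hsub

end Domain

/-! ### Maximum principle and three circles inequality -/

lemma integral_add_mul_cos_sq (p t : ℝ) :
    ∫ θ in (0 : ℝ)..2 * Real.pi, (p + t * Real.cos θ) ^ 2 = 2 * Real.pi * (p ^ 2 + t ^ 2 / 2) := by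
  have h : ∀ θ, (p + t * Real.cos θ) ^ 2
      = p ^ 2 + (2 * p * t * Real.cos θ + t ^ 2 * Real.cos θ ^ 2) := fun θ => by ring
  simp_rw [h]
  rw [intervalIntegral.integral_add intervalIntegrable_const
      (Continuous.intervalIntegrable (by fun_prop) _ _),
    intervalIntegral.integral_add (Continuous.intervalIntegrable (by fun_prop) _ _)
      (Continuous.intervalIntegrable (by fun_prop) _ _),
    intervalIntegral.integral_const_mul, intervalIntegral.integral_const_mul, integral_cos,
    integral_cos_sq]
  simp
  ring

/-- The surplus `t² / 2` makes `(Re z)²` the strictly subharmonic perturbation used in the maximum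
principle. -/
lemma circleAverage_re_sq (ζ : ℂ) (t : ℝ) :
    Real.circleAverage (fun z : ℂ => z.re ^ 2) ζ t = ζ.re ^ 2 + t ^ 2 / 2 := by
  have h : ∀ θ, (circleMap ζ t θ).re = ζ.re + t * Real.cos θ := fun θ => by
    simp [circleMap, Complex.exp_ofReal_mul_I_re]
  simp only [Real.circleAverage, h]
  rw [integral_add_mul_cos_sq, smul_eq_mul, inv_mul_cancel_left₀ Real.two_pi_pos.ne']

/-- The local sub-mean value inequality for a real function at `ζ`. -/
def SubmeanAt (h : ℂ → ℝ) (ζ : ℂ) : Prop :=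
  ∃ ρ : ℝ, 0 < ρ ∧ ∀ t : ℝ, 0 < t → t < ρ → h ζ ≤ Real.circleAverage h ζ t

/-- The maximum principle for continuous subharmonic functions. -/
lemma le_of_submeanAt {S V : Set ℂ} (hS : IsCompact S) (hV : IsOpen V) (hVS : V ⊆ S) {h : ℂ → ℝ}
    (hc : ContinuousOn h S) (hsub : ∀ ζ ∈ V, SubmeanAt h ζ) {M : ℝ} (hM : ∀ ζ ∈ S \ V, h ζ ≤ M)
    {ζ : ℂ} (hζ : ζ ∈ S) : h ζ ≤ M := by
  by_contra! hlt
  have hre : Continuous fun z : ℂ => z.re ^ 2 := by fun_prop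
  obtain ⟨B, hB⟩ := hS.exists_bound_of_continuousOn hre.continuousOn
  have hB' : ∀ z ∈ S, z.re ^ 2 ≤ B := fun z hz => (Real.le_norm_self _).trans (hB z hz)
  have hB0 : 0 ≤ B := (sq_nonneg _).trans (hB' ζ hζ)
  -- Small enough that `h + ε (Re z)²` still cannot attain its maximum off `V`; inside `V` a maximum
  -- would contradict the strict sub-mean inequality.
  set ε : ℝ := (h ζ - M) / (2 * (B + 1)) with hε
  have hε0 : 0 < ε := div_pos (by linarith) (by linarith)
  have hεB : ε * B < h ζ - M := by
    rw [hε, div_mul_eq_mul_div, div_lt_iff₀ (by linarith)]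
    nlinarith
  let g : ℂ → ℝ := fun z => h z + ε * z.re ^ 2
  have hgc : ContinuousOn g S := hc.add (continuous_const.mul hre).continuousOn
  obtain ⟨z₀, hz₀, hmax⟩ := hS.exists_isMaxOn ⟨ζ, hζ⟩ hgc
  have hζz : h ζ ≤ h z₀ + ε * z₀.re ^ 2 :=
    le_trans (le_add_of_nonneg_right (by positivity)) (hmax hζ)
  by_cases hz₀V : z₀ ∈ V
  · obtain ⟨ρ, hρ, hmean⟩ := hsub z₀ hz₀V
    obtain ⟨δ, hδ, hball⟩ := Metric.isOpen_iff.1 hV z₀ hz₀V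
    set t : ℝ := min ρ δ / 2 with ht
    have hm : 0 < min ρ δ := lt_min hρ hδ
    have ht0 : 0 < t := by positivity
    have htρ : t < ρ := (half_lt_self hm).trans_le (min_le_left _ _)
    have htδ : t < δ := (half_lt_self hm).trans_le (min_le_right _ _)
    have hsph : Metric.sphere z₀ |t| ⊆ S := fun z hz => hVS (hball (by
      rw [mem_sphere_iff_norm, abs_of_pos ht0] at hz
      rw [mem_ball_iff_norm, hz]
      exact htδ))
    have hi1 : CircleIntegrable h z₀ t :=
      ContinuousOn.circleIntegrable ht0.le (by rw [abs_of_pos ht0] at hsph; exact hc.mono hsph)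
    have hi2 : CircleIntegrable (fun z : ℂ => ε * z.re ^ 2) z₀ t :=
      (continuous_const.mul hre).continuousOn.circleIntegrable'
    have h1 : Real.circleAverage g z₀ t ≤ g z₀ :=
      Real.circleAverage_mono_on_of_le_circle (hi1.add hi2) fun z hz => hmax (hsph hz)
    have h2 : Real.circleAverage g z₀ t
        = Real.circleAverage h z₀ t + ε * (z₀.re ^ 2 + t ^ 2 / 2) := by
      rw [← circleAverage_re_sq z₀ t, ← smul_eq_mul ε, ← Real.circleAverage_fun_smul]
      exact Real.circleAverage_fun_add hi1 hi2
    have h3 := hmean t ht0 htρ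
    have h4 : 0 < ε * (t ^ 2 / 2) := by positivity
    simp only [g] at h1 h2
    linarith
  · have h1 := hM z₀ ⟨hz₀, hz₀V⟩
    have h2 := mul_le_mul_of_nonneg_left (hB' z₀ hz₀) hε0.le
    linarith

lemma circleAverage_log_norm {ζ : ℂ} {t : ℝ} (ht : 0 < t) (htζ : t < ‖ζ‖) :
    Real.circleAverage (fun z : ℂ => Real.log ‖z‖) ζ t = Real.log ‖ζ‖ := by
  have h := circleAverage_log_norm_sub_const_eq_log_radius_add_posLog (a := 0) (c := ζ) ht.ne'
  simp only [sub_zero] at h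
  have h1 : 1 ≤ t⁻¹ * ‖ζ‖ := by
    rw [inv_mul_eq_div, one_le_div ht]
    exact htζ.le
  rw [h, Real.posLog_eq_log (by rw [abs_of_nonneg (by positivity)]; exact h1),
    Real.log_mul (by positivity) (ht.trans htζ).ne', Real.log_inv]
  ring

/-- The three circles inequality for continuous subharmonic functions. -/
lemma le_add_log_of_submeanAt {h : ℂ → ℝ} {r₀ R m₀ C B : ℝ} (hr₀ : 0 < r₀)
    (hc : ContinuousOn h {z | r₀ ≤ ‖z‖ ∧ ‖z‖ ≤ R})
    (hsub : ∀ z, r₀ < ‖z‖ → ‖z‖ < R → SubmeanAt h z)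
    (h₀ : ∀ z, ‖z‖ = r₀ → h z ≤ m₀) (hC : ∀ z, ‖z‖ = R → h z ≤ C)
    (hB : C ≤ m₀ + B * (Real.log R - Real.log r₀)) {z : ℂ} (hz₀ : r₀ ≤ ‖z‖) (hzR : ‖z‖ ≤ R) :
    h z ≤ m₀ + B * (Real.log ‖z‖ - Real.log r₀) := by
  have hlog : ContinuousOn (fun z : ℂ => Real.log ‖z‖) {z | r₀ ≤ ‖z‖} :=
    continuous_norm.continuousOn.log fun z hz => (hr₀.trans_le hz).ne'
  have hcompact : IsCompact {z : ℂ | r₀ ≤ ‖z‖ ∧ ‖z‖ ≤ R} := by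
    refine (isCompact_closedBall (0 : ℂ) R).of_isClosed_subset
      ((isClosed_le continuous_const continuous_norm).inter
        (isClosed_le continuous_norm continuous_const)) fun z hz => ?_
    rw [mem_closedBall_zero_iff]
    exact hz.2
  -- Since `log |z|` is harmonic off `0`, subtracting `B log |z|` preserves the sub-mean inequality;
  -- `hB` bounds the difference by `M` on the outer circle.
  have key := le_of_submeanAt (h := fun z => h z - B * Real.log ‖z‖) (M := m₀ - B * Real.log r₀)
    (V := {z : ℂ | r₀ < ‖z‖ ∧ ‖z‖ < R}) hcompact
    ((isOpen_lt continuous_const continuous_norm).inter (isOpen_lt continuous_norm continuous_const))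
    (fun z hz => ⟨hz.1.le, hz.2.le⟩)
    (hc.sub (continuousOn_const.mul (hlog.mono fun z hz => hz.1))) (fun z hz => ?_) (fun z hz => ?_)
    (ζ := z) ⟨hz₀, hzR⟩
  · linarith
  · obtain ⟨ρ, hρ, hm⟩ := hsub z hz.1 hz.2
    refine ⟨min ρ (min (‖z‖ - r₀) (R - ‖z‖)), lt_min hρ (lt_min (sub_pos.2 hz.1) (sub_pos.2 hz.2)),
      fun t ht htρ => ?_⟩
    obtain ⟨ht1, ht2, ht3⟩ : t < ρ ∧ t < ‖z‖ - r₀ ∧ t < R - ‖z‖ := by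
      simpa [lt_min_iff] using htρ
    have hsph : Metric.sphere z t ⊆ {z | r₀ ≤ ‖z‖ ∧ ‖z‖ ≤ R} := fun w hw => by
      rw [mem_sphere_iff_norm] at hw
      have h1 := abs_le.1 (abs_norm_sub_norm_le w z)
      exact ⟨by linarith [h1.1], by linarith [h1.2]⟩
    have hi1 : CircleIntegrable h z t := (hc.mono hsph).circleIntegrable ht.le
    have hi2 : CircleIntegrable (fun z : ℂ => B * Real.log ‖z‖) z t :=
      ((continuousOn_const.mul hlog).mono fun w hw => (hsph hw).1).circleIntegrable ht.le
    have h2 : Real.circleAverage (fun z => h z - B * Real.log ‖z‖) z t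
        = Real.circleAverage h z t - B * Real.log ‖z‖ := by
      rw [← circleAverage_log_norm ht (by linarith), ← smul_eq_mul B, ← Real.circleAverage_fun_smul]
      exact Real.circleAverage_fun_sub hi1 hi2
    rw [h2]
    linarith [hm t ht ht1]
  · rcases hz.1.1.eq_or_lt with he | hlt
    · rw [← he]
      linarith [h₀ z he.symm]
    · have he : ‖z‖ = R := le_antisymm hz.1.2 (not_lt.1 fun hlt' => hz.2 ⟨hlt, hlt'⟩)
      rw [he]
      linarith [hC z he]

/-! ### Restriction to slices and compactness -/

section Slices

variable {m : ℕ}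

lemma joinPt_add_smul (e : Cn m) (ζ s w : ℂ) :
    joinPt ((ζ + s) • e) w = joinPt (ζ • e) w + s • joinPt e 0 := by
  ext i
  refine Fin.lastCases ?_ (fun j => ?_) i
  · simp [joinPt]
  · simp [joinPt, add_mul]

lemma continuous_joinPt_smul (e : Cn m) : Continuous fun p : ℂ × ℂ => joinPt (p.1 • e) p.2 :=
  continuous_joinPt.comp (by fun_prop : Continuous fun p : ℂ × ℂ => (p.1 • e, p.2))

lemma submeanAt_slice {D : Set (Cn (m + 1))} (hD : IsOpen D) {v : Cn (m + 1) → ℝ}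
    (hv : ContinuousOn v D) (hpsh : IsPSHOn (fun z => (v z : EReal)) D) (e : Cn m) {ζ w : ℂ}
    (hζ : joinPt (ζ • e) w ∈ D) : SubmeanAt (fun ζ => v (joinPt (ζ • e) w)) ζ := by
  obtain ⟨ρ₁, hρ₁, h₁⟩ := exists_forall_circle_mem (hD.mem_nhds hζ) (joinPt e 0)
  obtain ⟨ρ₂, hρ₂, h₂⟩ := hpsh.submean _ hζ (joinPt e 0)
  refine ⟨min ρ₁ ρ₂, lt_min hρ₁ hρ₂, fun t ht htρ => ?_⟩
  have hmem := h₁ t ht (htρ.trans_le (min_le_left _ _))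
  have hmean := h₂ t ht (htρ.trans_le (min_le_right _ _))
  have hcont : Continuous fun θ : ℝ =>
      v (joinPt (ζ • e) w + ((t : ℂ) * Complex.exp (θ * Complex.I)) • joinPt e 0) :=
    hv.comp_continuous (by fun_prop) hmem
  rw [circleMean_coe (f := fun θ =>
      v (joinPt (ζ • e) w + ((t : ℂ) * Complex.exp (θ * Complex.I)) • joinPt e 0))
    hcont.integrableOn_Ioc, EReal.coe_le_coe_iff] at hmean
  rw [Real.circleAverage, intervalIntegral.integral_of_le Real.two_pi_pos.le, smul_eq_mul,
    ← div_eq_inv_mul]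
  simpa only [circleMap, joinPt_add_smul] using hmean

lemma eventually_forall_slice_lt {D : Set (Cn (m + 1))} (hD : IsOpen D) {v : Cn (m + 1) → ℝ}
    (hv : ContinuousOn v D) (e : Cn m) {S : Set ℂ} (hS : IsCompact S) {a : ℂ} {M : ℝ}
    (hSD : ∀ ζ ∈ S, joinPt (ζ • e) a ∈ D) (hM : ∀ ζ ∈ S, v (joinPt (ζ • e) a) < M) :
    ∀ᶠ w in 𝓝 a, ∀ ζ ∈ S, v (joinPt (ζ • e) w) < M := by
  refine hS.eventually_forall_of_forall_eventually fun ζ hζ => ?_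
  have h1 : ContinuousAt (fun p : ℂ × ℂ => v (joinPt (p.2 • e) p.1)) (a, ζ) :=
    ContinuousAt.comp (g := v) (f := fun p : ℂ × ℂ => joinPt (p.2 • e) p.1)
      (hv.continuousAt (hD.mem_nhds (hSD ζ hζ)))
      ((continuous_joinPt_smul e).comp continuous_swap).continuousAt
  exact h1.eventually_lt_const (hM ζ hζ)

/-- Dini's argument: strict inequalities persist nearby by continuity, and monotonicity lets
finitely many indices be replaced by their maximum. -/
lemma exists_forall_lt_of_antitone {D T : Set (Cn (m + 1))} {v : ℕ → Cn (m + 1) → ℝ}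
    (hv : ∀ q, ContinuousOn (v q) D) (hanti : ∀ z ∈ D, Antitone fun q => v q z) (hT : IsCompact T)
    (hTD : T ⊆ D) {M : ℝ} (h : ∀ z ∈ T, ∃ q, v q z < M) : ∃ q, ∀ z ∈ T, v q z < M := by
  suffices ∃ q, ∀ z ∈ T ∩ D, v q z < M from this.imp fun q hq z hz => hq z ⟨hz, hTD hz⟩
  refine hT.induction_on (p := fun s => ∃ q, ∀ z ∈ s ∩ D, v q z < M) (by simp)
    (fun s t hst ⟨q, hq⟩ => ⟨q, fun z hz => hq z ⟨hst hz.1, hz.2⟩⟩) ?_ fun z hz => ?_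
  · rintro s t ⟨q₁, h₁⟩ ⟨q₂, h₂⟩
    refine ⟨max q₁ q₂, fun z ⟨hz, hzD⟩ => ?_⟩
    rcases hz with hz | hz
    · exact (hanti z hzD (le_max_left _ _)).trans_lt (h₁ z ⟨hz, hzD⟩)
    · exact (hanti z hzD (le_max_right _ _)).trans_lt (h₂ z ⟨hz, hzD⟩)
  · obtain ⟨q, hq⟩ := h z hz
    have h1 := ((hv q z (hTD hz)).mono hTD).eventually_lt_const hq
    exact ⟨_, h1, q, fun y hy => hy.1⟩

end Slices

/-! ### Failure of smooth approximation -/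

section NotApproximable

variable {m : ℕ} {x c r : ℕ → ℝ}

/-- The condition `5a < 2` is `(2a)² + (a - 1)² < 1`: the disc `|ζ| ≤ 2a` over `a` fits in the ball.
-/
lemma exists_mem_setA_joinPt_mem {U : Set (Cn (m + 1))} (hU : IsOpen U) (h0 : 0 ∈ U) :
    ∃ a ∈ setA, 0 < a ∧ 5 * a < 2 ∧
      ∀ (v : Cn m) (w : ℂ), ‖v‖ ≤ 2 * a → ‖w‖ ≤ 2 * a → joinPt v w ∈ U := by
  have hz : joinPt (0 : Cn m) 0 = 0 := joinPt_fstPart_lastPart (0 : Cn (m + 1))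
  have hn : (fun p : Cn m × ℂ => joinPt p.1 p.2) ⁻¹' U ∈ 𝓝 ((0 : Cn m), (0 : ℂ)) :=
    continuous_joinPt.continuousAt (by rw [hz]; exact hU.mem_nhds h0)
  obtain ⟨δ, hδ, hball⟩ := Metric.mem_nhds_iff.1 hn
  obtain ⟨n, hn⟩ := exists_nat_one_div_lt (lt_min (half_pos hδ) (by norm_num : (0 : ℝ) < 2 / 5))
  obtain ⟨hn1, hn2⟩ := lt_min_iff.1 hn
  refine ⟨1 / ((n : ℝ) + 1), ⟨n + 1, by omega, by simp⟩, by positivity, by linarith,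
    fun v w hv hw => hball (a := (v, w)) ?_⟩
  rw [mem_ball_iff_norm, Prod.mk_sub_mk, sub_zero, sub_zero, Prod.norm_mk]
  exact max_lt (by linarith) (by linarith)

lemma norm_ofReal_of_pos {a : ℝ} (ha : 0 < a) : ‖(a : ℂ)‖ = a := by
  rw [Complex.norm_real, Real.norm_of_nonneg ha.le]

lemma eventually_nhds_ofReal {a : ℝ} (ha : 0 < a) (ha' : 5 * a < 2) :
    ∀ᶠ w in 𝓝 (a : ℂ), ‖w‖ ≤ 2 * a ∧ (2 * a) ^ 2 + ‖w - 1‖ ^ 2 < 1 := by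
  refine Eventually.and ((continuous_norm.tendsto _).eventually_le_const ?_)
    (((by fun_prop : Continuous fun w : ℂ => (2 * a) ^ 2 + ‖w - 1‖ ^ 2).tendsto
      (a : ℂ)).eventually_lt_const ?_)
  · rw [norm_ofReal_of_pos ha]
    linarith
  · rw [norm_ofReal_sub_one_sq]
    nlinarith

/-- Neither of the two functions is a decreasing limit of smooth plurisubharmonic functions near `0`:
on discs in the slices `z_n = x_j`, with `x_j` close to a point of `A`, approximants would violate
the three circles inequality or the maximum principle. -/
lemma not_isDecreasingSmoothLimitOn (hm : 1 ≤ m) (hx : IsPoints x) (hc : IsCoeffs x c)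
    (hr : IsRadii x c r) {U : Set (Cn (m + 1))} (hU : IsOpen U) (h0 : 0 ∈ U) {u : Cn (m + 1) → EReal}
    (hu : u = exampleFun m x c ∨ u = exampleFunSwap m x c) :
    ¬ IsDecreasingSmoothLimitOn u (U ∩ Omega m x r) := by
  rintro ⟨v, hv, hdec, hlim⟩
  obtain ⟨a, haA, ha0, ha5, haU⟩ := exists_mem_setA_joinPt_mem hU h0
  set D := U ∩ Omega m x r
  have hD : IsOpen D := hU.inter isOpen_Omega
  have hcont : ∀ q, ContinuousOn (v q) D := fun q => (hv q).1.continuousOn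
  have hanti : ∀ z ∈ D, Antitone fun q => v q z := fun z hz =>
    antitone_nat_of_succ_le fun q => hdec q z hz
  have hge : ∀ z ∈ D, ∀ q, u z ≤ (v q z : EReal) := fun z hz q =>
    Antitone.le_of_tendsto (f := fun q => (v q z : EReal))
      (fun i j hij => EReal.coe_le_coe_iff.2 (hanti z hz hij)) (hlim z hz) q
  have hlt : ∀ z ∈ D, ∀ M : ℝ, u z < M → ∃ q, v q z < M := fun z hz M hM => by
    obtain ⟨q, hq⟩ := ((hlim z hz).eventually_lt_const hM).exists
    exact ⟨q, EReal.coe_lt_coe_iff.1 hq⟩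
  let e : Cn m := EuclideanSpace.single ⟨0, hm⟩ 1
  have he : ∀ ζ : ℂ, ‖ζ • e‖ = ‖ζ‖ := fun ζ => by simp [e, norm_smul]
  have hlam : ((-1 / 2 : ℝ) : EReal) ≤ lam x c (a : ℂ) := hc.ge_on_A a haA
  have hev := eventually_nhds_ofReal ha0 ha5
  have hmemA : ∀ ζ : ℂ, ‖ζ‖ ≤ 2 * a → ‖ζ‖ ≠ a → joinPt (ζ • e) (a : ℂ) ∈ D := fun ζ h1 h2 => by
    obtain ⟨h3, h4⟩ := hev.self_of_nhds
    refine ⟨haU _ _ (by rwa [he]) h3, joinPt_mem_Omega ?_ fun h => ?_⟩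
    · refine lt_of_le_of_lt ?_ h4
      rw [he]
      gcongr
    · rw [he, norm_ofReal_of_pos ha0] at h
      exact absurd h h2
  have hmemX : ∀ ζ : ℂ, ‖ζ‖ ≤ 2 * a → ∀ j : ℕ, ‖(x j : ℂ)‖ ≤ 2 * a →
      (2 * a) ^ 2 + ‖(x j : ℂ) - 1‖ ^ 2 < 1 → joinPt (ζ • e) (x j : ℂ) ∈ D := fun ζ h1 j h3 h4 => by
    refine ⟨haU _ _ (by rwa [he]) h3, joinPt_mem_Omega ?_ fun _ =>
      ⟨j, Metric.mem_ball_self (hr.pos j)⟩⟩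
    refine lt_of_le_of_lt ?_ h4
    rw [he]
    gcongr
  have hpick : ∀ {P : ℂ → Prop}, (∀ᶠ w in 𝓝 (a : ℂ), P w) → ∃ j, P (x j : ℂ) := fun {P} hP => by
    have hcl : MapClusterPt a atTop x := by
      have : a ∈ {a : ℝ | MapClusterPt a atTop x} := by
        rw [hx.limits]
        exact subset_closure haA
      exact this
    exact (mapClusterPt_iff_frequently.1 hcl _
      (Complex.continuous_ofReal.continuousAt.eventually hP)).exists
  have hsliceC : ∀ (q : ℕ) (S : Set ℂ) (w : ℂ), (∀ ζ ∈ S, joinPt (ζ • e) w ∈ D) →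
      ContinuousOn (fun ζ => v q (joinPt (ζ • e) w)) S := fun q S w hS =>
    (hcont q).comp ((continuous_joinPt_smul e).comp
      (continuous_id.prodMk continuous_const)).continuousOn hS
  have hsliceS : ∀ (q : ℕ) (ζ w : ℂ), joinPt (ζ • e) w ∈ D →
      SubmeanAt (fun ζ => v q (joinPt (ζ • e) w)) ζ := fun q ζ w hζ =>
    submeanAt_slice hD (hcont q) (hv q).2 e hζ
  -- The levels satisfy `-1 < -3/4 < -5/8 < -1/2`: the first two pairs leave room for approximation
  -- on the low side and for the contradiction, the last for continuity on the high side.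
  have hsmall : ∀ s : ℝ, s ≤ 2 * a → s ≠ a → (∀ ζ : ℂ, ‖ζ‖ = s → u (joinPt (ζ • e) (a : ℂ)) = -1) →
      ∃ q, ∀ᶠ w in 𝓝 (a : ℂ), ∀ ζ : ℂ, ‖ζ‖ = s → v q (joinPt (ζ • e) w) < -3 / 4 := by
    intro s hs hsa hus
    have hSD : ∀ ζ ∈ Metric.sphere (0 : ℂ) s, joinPt (ζ • e) (a : ℂ) ∈ D := fun ζ hζ => by
      rw [mem_sphere_zero_iff_norm] at hζ
      exact hmemA ζ (hζ ▸ hs) (hζ ▸ hsa)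
    obtain ⟨q, hq⟩ := exists_forall_lt_of_antitone (M := -3 / 4) hcont hanti
      ((isCompact_sphere (0 : ℂ) s).image (f := fun ζ => joinPt (ζ • e) (a : ℂ))
        ((continuous_joinPt_smul e).comp (continuous_id.prodMk continuous_const)))
      (by rintro _ ⟨ζ, hζ, rfl⟩; exact hSD ζ hζ) (by
        rintro _ ⟨ζ, hζ, rfl⟩
        refine hlt _ (hSD ζ hζ) _ ?_
        rw [hus ζ (mem_sphere_zero_iff_norm.1 hζ)]
        exact EReal.coe_lt_coe_iff.2 (by norm_num : (-1 : ℝ) < -3 / 4))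
    refine ⟨q, ?_⟩
    filter_upwards [eventually_forall_slice_lt hD (hcont q) e (isCompact_sphere (0 : ℂ) s) hSD
      fun ζ hζ => hq _ ⟨ζ, hζ, rfl⟩] with w hw ζ hζ
    exact hw ζ (mem_sphere_zero_iff_norm.2 hζ)
  have hlarge : ∀ ζ : ℂ, ‖ζ‖ ≤ 2 * a → ‖ζ‖ ≠ a →
      u (joinPt (ζ • e) (a : ℂ)) = max (lam x c (a : ℂ)) (-1) →
      ∀ q, ∀ᶠ w in 𝓝 (a : ℂ), -5 / 8 < v q (joinPt (ζ • e) w) := by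
    intro ζ h1 h2 h3 q
    have h4 := hge _ (hmemA ζ h1 h2) q
    rw [h3] at h4
    have h5 := EReal.coe_le_coe_iff.1 (hlam.trans ((le_max_left _ _).trans h4))
    have h6 := eventually_forall_slice_lt hD (hcont q).neg e (isCompact_singleton (x := ζ))
      (a := (a : ℂ)) (M := 5 / 8) (by rintro _ rfl; exact hmemA _ h1 h2)
      (by rintro _ rfl; simp only [Pi.neg_apply]; linarith)
    filter_upwards [h6] with w hw
    have := hw ζ rfl
    simp only [Pi.neg_apply] at this
    linarith
  rcases hu with rfl | rfl
  -- The outer bound is taken from `v 0`, which dominates every `v q`; hence `C`, `B` and `η` can be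
  -- fixed before `q`.
  · obtain ⟨C, hC⟩ := (isCompact_sphere (0 : ℂ) (2 * a)).exists_bound_of_continuousOn
      (hsliceC 0 (Metric.sphere (0 : ℂ) (2 * a)) (a : ℂ) fun ζ hζ => by
        rw [mem_sphere_zero_iff_norm] at hζ
        exact hmemA ζ hζ.le (by rw [hζ]; linarith))
    have hCev := eventually_forall_slice_lt hD (hcont 0) e (isCompact_sphere (0 : ℂ) (2 * a))
      (a := (a : ℂ)) (M := |C| + 1) (fun ζ hζ => by
        rw [mem_sphere_zero_iff_norm] at hζ
        exact hmemA ζ hζ.le (by rw [hζ]; linarith)) (fun ζ hζ => by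
        have := (Real.le_norm_self _).trans (hC ζ hζ)
        linarith [le_abs_self C])
    have hl2 : 0 < Real.log 2 := Real.log_pos one_lt_two
    -- The radii `a e^{-η}` and `2a` have log-ratio `log 2 + η`, and `B log 2 = |C| + 2` exceeds the
    -- rise from `-3/4` to `|C| + 1`.
    set B : ℝ := (|C| + 2) / Real.log 2 with hB
    have hB0 : 0 < B := by positivity
    have hBl : B * Real.log 2 = |C| + 2 := div_mul_cancel₀ _ hl2.ne'
    -- The first bound keeps `a e^η ≤ 2a`; the second limits the growth from `a e^{-η}` to `a e^η`
    -- to `2ηB ≤ 1/8`, the distance from `-3/4` to `-5/8`.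
    set η : ℝ := min (Real.log 2) (1 / (16 * B)) with hη
    have hη0 : 0 < η := by positivity
    have hηB : 2 * η * B ≤ 1 / 8 := by
      have : η * (16 * B) ≤ 1 := (le_div_iff₀ (by positivity)).1 (min_le_right _ _)
      linarith
    have hexp1 : 1 < Real.exp η := Real.one_lt_exp_iff.2 hη0
    have hexp2 : Real.exp η ≤ 2 := by
      rw [← Real.le_log_iff_exp_le two_pos]
      exact min_le_left _ _
    have hr₀a : a / Real.exp η < a := div_lt_self ha0 hexp1
    have hr₀ : 0 < a / Real.exp η := by positivity
    have hr₁ : ‖((a * Real.exp η : ℝ) : ℂ)‖ = a * Real.exp η := norm_ofReal_of_pos (by positivity)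
    obtain ⟨q, hq⟩ := hsmall (a / Real.exp η) (by linarith) hr₀a.ne fun ζ hζ => by
      rw [exampleFun, fstPart_joinPt, lastPart_joinPt, he, hζ, norm_ofReal_of_pos ha0]
      exact if_pos hr₀a
    have hl := hlarge ((a * Real.exp η : ℝ) : ℂ) (by rw [hr₁]; nlinarith) (by rw [hr₁]; nlinarith)
      (by
        rw [exampleFun, fstPart_joinPt, lastPart_joinPt, he, hr₁, norm_ofReal_of_pos ha0]
        exact if_neg (by nlinarith)) q
    obtain ⟨j, hj1, hj2, hj3, hj4, hj5⟩ := hpick (hq.and (hl.and (hCev.and hev)))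
    have hlr₀ : Real.log (a / Real.exp η) = Real.log a - η := by
      rw [Real.log_div ha0.ne' (Real.exp_pos _).ne', Real.log_exp]
    have key := le_add_log_of_submeanAt (h := fun ζ => v q (joinPt (ζ • e) (x j : ℂ)))
      (r₀ := a / Real.exp η) (R := 2 * a) (m₀ := -3 / 4) (C := |C| + 1) (B := B) hr₀
      (hsliceC q _ _ fun ζ hζ => hmemX ζ hζ.2 j hj4 hj5)
      (fun ζ _ hζ => hsliceS q ζ _ (hmemX ζ hζ.le j hj4 hj5)) (fun ζ hζ => (hj1 ζ hζ).le)
      (fun ζ hζ => (hanti _ (hmemX ζ hζ.le j hj4 hj5) (Nat.zero_le q)).trans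
        (hj3 ζ (mem_sphere_zero_iff_norm.2 hζ)).le)
      (by
        rw [hlr₀, Real.log_mul two_ne_zero ha0.ne']
        nlinarith)
      (z := ((a * Real.exp η : ℝ) : ℂ)) (by rw [hr₁]; nlinarith) (by rw [hr₁]; nlinarith)
    rw [hlr₀, hr₁, Real.log_mul ha0.ne' (Real.exp_pos _).ne', Real.log_exp] at key
    linarith
  -- With the pieces exchanged, the slice over `x_j` is below `-3/4` on `|ζ| = 2a` but above `-5/8`
  -- at the centre.
  · obtain ⟨q, hq⟩ := hsmall (2 * a) le_rfl (by linarith) fun ζ hζ => by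
      rw [exampleFunSwap, fstPart_joinPt, lastPart_joinPt, he, hζ, norm_ofReal_of_pos ha0]
      exact if_neg (by linarith)
    have hl := hlarge 0 (by rw [norm_zero]; linarith) (by rw [norm_zero]; exact ha0.ne) (by
      rw [exampleFunSwap, fstPart_joinPt, lastPart_joinPt, he, norm_zero, norm_ofReal_of_pos ha0]
      exact if_pos ha0) q
    obtain ⟨j, hj1, hj2, hj4, hj5⟩ := hpick (hq.and (hl.and hev))
    have key := le_of_submeanAt (h := fun ζ => v q (joinPt (ζ • e) (x j : ℂ))) (M := -3 / 4)
      (isCompact_closedBall (0 : ℂ) (2 * a)) Metric.isOpen_ball Metric.ball_subset_closedBall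
      (hsliceC q _ _ fun ζ hζ => hmemX ζ (mem_closedBall_zero_iff.1 hζ) j hj4 hj5)
      (fun ζ hζ => hsliceS q ζ _ (hmemX ζ (mem_ball_zero_iff.1 hζ).le j hj4 hj5))
      (fun ζ hζ => (hj1 ζ (le_antisymm (mem_closedBall_zero_iff.1 hζ.1)
        (not_lt.1 fun h => hζ.2 (mem_ball_zero_iff.2 h)))).le)
      (Metric.mem_closedBall_self (by linarith))
    linarith

end NotApproximable

end PSHExample

end

theorem mainTheorem4 (m : ℕ) (hm : 1 ≤ m) :
    (∃ x : ℕ → ℝ, PSHExample.IsPoints x) ∧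
    (∀ x : ℕ → ℝ, PSHExample.IsPoints x → ∃ c : ℕ → ℝ, PSHExample.IsCoeffs x c) ∧
    (∀ x c : ℕ → ℝ, PSHExample.IsPoints x → PSHExample.IsCoeffs x c →
      ∃ r : ℕ → ℝ, PSHExample.IsRadii x c r) ∧
    ∀ x c r : ℕ → ℝ, PSHExample.IsPoints x → PSHExample.IsCoeffs x c →
      PSHExample.IsRadii x c r →
      IsOpen (PSHExample.Omega m x r) ∧ IsConnected (PSHExample.Omega m x r) ∧
      (0 : PSHExample.Cn (m + 1)) ∈ frontier (PSHExample.Omega m x r) ∧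
      (∀ u : PSHExample.Cn (m + 1) → EReal,
        u = PSHExample.exampleFun m x c ∨ u = PSHExample.exampleFunSwap m x c →
        PSHExample.IsPSHOn u (PSHExample.Omega m x r) ∧
        ∀ U : Set (PSHExample.Cn (m + 1)), IsOpen U → (0 : PSHExample.Cn (m + 1)) ∈ U →
          ¬ PSHExample.IsDecreasingSmoothLimitOn u (U ∩ PSHExample.Omega m x r)) ∧
      ∀ U : Set (PSHExample.Cn (m + 1)), IsOpen U → (0 : PSHExample.Cn (m + 1)) ∈ U →
        ¬ PSHExample.IsSDomain (U ∩ PSHExample.Omega m x r) := by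
  refine ⟨PSHExample.exists_isPoints, fun x hx => PSHExample.exists_isCoeffs hx,
    fun x c _ hc => PSHExample.exists_isRadii hc, fun x c r hx hc hr =>
    ⟨PSHExample.isOpen_Omega, PSHExample.isConnected_Omega hm (fun k => (hx.mem k).1) hr.pos,
      PSHExample.zero_mem_frontier_Omega, fun u hu => ⟨?_, fun U hU h0 =>
        PSHExample.not_isDecreasingSmoothLimitOn hm hx hc hr hU h0 hu⟩, fun U hU h0 hS => ?_⟩⟩
  · rcases hu with rfl | rfl
    · exact PSHExample.isPSHOn_exampleFun hc.subharmonic hr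
    · exact PSHExample.isPSHOn_exampleFunSwap hc.subharmonic hr
  · exact PSHExample.not_isDecreasingSmoothLimitOn hm hx hc hr hU h0 (Or.inl rfl)
      (hS.2.2 _ ((PSHExample.isPSHOn_exampleFun hc.subharmonic hr).mono inter_subset_right))
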